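/- **Setting.** Let $K\ge 3$ be an odd number of users and let $W_1,\dots,W_N$ be files of $F$ bits each, ordered by non-increasing popularity, with $\binom K2\mid F$. A server is connected to the users by a shared error-free link. Let $N_h+N_r\le N$. The first $N_h$ files are high-level, the last $N_r$ files are zero-level, the others are low-level. Every file $W_n$ is split into $\binom K2$ sub-files $W_{n,s}$ of equal size, indexed by the 2-subsets $s$ of $[K]$. **Placement.** If $W_n$ is high-level, $W_{n,s}$ is stored by the two users in $s$. The sub-files of a low-level file are divided into $K$ disjoint sets of $\frac{K-1}2$ sub-files, and each user stores exactly one of these sets (a different one for each user). Zero-level files are not cached. **Demands.** Let $\mathbf d=(d_1,\dots,d_K)$ be a demand vector; $\mathcal K^h,\mathcal K^l,\mathcal K^r$ are the sets of users that request a high-, low-, zero-level file, $k^h,k^l,k^r$ their cardinalities, $\mathbf k=[k^h,k^l,k^r]$. For $i\in\mathcal K^h$, $j\in\mathcal K^l$ let $\mathcal H_{i,j}$ be the set of sub-files of $W_{d_j}$ stored by $i$ (more generally, $\mathcal H_{k,j}$ for any user $k$), and let $\Omega_{i,j}$ (resp. $\mathcal Z_{i,j}$) be the set of sub-files $W_{d_i,\{k,j\}}$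 with $k\in\mathcal K^h\setminus\{i\}$ (resp. $k\in\mathcal K^r$). The set $\Lambda_i=\{W_{d_i,s}: s\subseteq\mathcal K^l\}$ is partitioned into sets $\Lambda_{i,j}$, $j\in\mathcal K^l$, of sub-files stored by $j$ whose cardinalities differ by at most one, the partition of the index sets $s$ being the same for all $i$. Put, with $(x)^+=\max(x,0)$, $$\sigma_{i,j}=\big(|\Lambda_{i,j}|+|\mathcal Z_{i,j}|-|\mathcal H_{i,j}|\big)^+,\qquad n_{i,j}=\Big(|\Omega_{i,j}|-\big(|\mathcal H_{i,j}|-|\Lambda_{i,j}|-|\mathcal Z_{i,j}|\big)^+\Big)^+ .$$ Choose $\Pi_{i,j}\subseteq\mathcal Z_{i,j}$ with $|\mathcal Z_{i,j}\setminus\Pi_{i,j}|=\sigma_{i,j}$, $\Delta_{i,j}\subseteq\Omega_{i,j}$ with $|\Delta_{i,j}|=n_{i,j}$, and put $\mathcal F_{i,j}=\Lambda_{i,j}\cup\Pi_{i,j}\cup(\Omega_{i,j}\setminus\Delta_{i,j})$. **Delivery.** The server sends the following messages. 1. For every 3-subset $S\subseteq\mathcal K^h\cup\mathcal K^r$ with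 $S\not\subseteq\mathcal K^r$: $\bigoplus_{s\in S\cap\mathcal K^h}W_{d_s,S\setminus\{s\}}$. 2. For every pair $\{j,k\}\subseteq\mathcal K^l$: the XORs $w\oplus w'$ of the sub-files $w\in\mathcal H_{k,j}$ with the sub-files $w'\in\mathcal H_{j,k}$ matched to them by a bijection. 3. For every $i\in\mathcal K^h$, $j\in\mathcal K^l$, given an injection $\mathcal F_{i,j}\to\mathcal H_{i,j}$: every sub-file in $\mathcal H_{i,j}$, XORed with the member of $\mathcal F_{i,j}$ mapped to it (if there is one). 4. The sub-files in the sets $\Delta_{i,j}$ (each counted for the user $i$ requesting it), grouped into XORs of two sub-files, requested by two distinct high-level users each of which stores the sub-file requested by the other, with at most one sub-file left over and sent alone. 5. Unicasts: the sub-files requested by low-level users and stored by zero-level users; the sub-files in the sets $\mathcal Z_{i,j}\setminus\Pi_{i,j}$; all the sub-files of the file requested by each zero-level user. **Claim.** Such placements exist, and each of them uses exactly $MF$ bits of cache at every user, where $M=\frac{N_h+N-N_r}{K}$. For every such placement and every $\mathbf d$ the choices required by the delivery can be made, and however they are made: * $|\mathcal Z_{i,j}|=k^r$, $|\Omega_{i,j}|=k^h-1$,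 $|\mathcal H_{i,j}|=\frac{K-1}2$ and $|\Lambda_{i,j}|\in\{\lfloor\frac{k^l-1}2\rfloor,\lceil\frac{k^l-1}2\rceil\}$ in the formulas for $\sigma_{i,j}$ and $n_{i,j}$; and $|\mathcal F_{i,j}|=|\mathcal H_{i,j}|$ unless $k^h=1$ and $k^r=0$; * apart from the $k^r\binom K2$ unicasts to zero-level users, the number of messages sent is $$N_T(\mathbf k)=\underbrace{\tbinom{k^h+k^r}3-\tbinom{k^r}3}_{\text{Step 1}}+\underbrace{\tfrac{K-1}2\tbinom{k^l}2}_{\text{Step 2}}+\underbrace{\tfrac{K-1}2k^hk^l}_{\text{Step 3}}+\underbrace{\Big\lceil\tfrac12\sum_{i,j}n_{i,j}\Big\rceil}_{\text{Step 4}}+\underbrace{k^lk^r\tfrac{K-1}2+\sum_{i,j}\sigma_{i,j}}_{\text{Step 5}},$$ which depends on $\mathbf d$ only through $\mathbf k$: for each $i$, exactly $\lceil k^l/2\rceil$ of the sets $\Lambda_{i,j}$ can be taken to have $\lfloor\frac{k^l-1}2\rfloor$ elements and the other $\lfloor k^l/2\rfloor$ to have $\lceil\frac{k^l-1}2\rceil$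 elements in evaluating the sums; * every user recovers the requested file from the messages and the own cache, and the number of bits sent, divided by $F$, is $$R(\mathbf k)=\frac{N_T(\mathbf k)}{\binom K2}+k^r .$$ -/

import Mathlib

open Finset

namespace CL210

/-- Indices of sub-files: the 2-subsets of the set of `K` users; every file has `C(K,2)` sub-files. -/
abbrev Pair (K : ℕ) : Type := {s : Finset (Fin K) // s.card = 2}

/-- The sub-file `W_{n,s}`, as a label: a file `n` and a 2-subset `s` of users. -/
abbrev SubFile (K N : ℕ) : Type := Fin N × Pair K

/-- The content of a sub-file: `b` bits, with addition in `ZMod 2` as XOR.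
A file thus consists of `F = C(K,2) * b` bits. -/
abbrev Bits (b : ℕ) : Type := Fin b → ZMod 2

/-- A realization of the whole library. -/
abbrev Library (K N b : ℕ) : Type := Fin N → Pair K → Bits b

/-- The file size in bits. -/
def fileSize (K b : ℕ) : ℕ := K.choose 2 * b

/-! Files are indexed by popularity rank (file `0` is the most popular one): the first `Nh` files are
high-level, the last `Nr` files are not cached (zero-level), those in between are low-level. -/

def IsHigh {N : ℕ} (Nh : ℕ) (n : Fin N) : Prop := n.val < Nh
def IsZero {N : ℕ} (Nr : ℕ) (n : Fin N) : Prop := N ≤ n.val + Nr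
def IsLow {N : ℕ} (Nh Nr : ℕ) (n : Fin N) : Prop := ¬ IsHigh Nh n ∧ ¬ IsZero Nr n

instance {N : ℕ} (Nh : ℕ) : DecidablePred (IsHigh (N := N) Nh) :=
  fun n => inferInstanceAs (Decidable (n.val < Nh))
instance {N : ℕ} (Nr : ℕ) : DecidablePred (IsZero (N := N) Nr) :=
  fun n => inferInstanceAs (Decidable (N ≤ n.val + Nr))
instance {N : ℕ} (Nh Nr : ℕ) : DecidablePred (IsLow (N := N) Nh Nr) :=
  fun n => inferInstanceAs (Decidable (¬ IsHigh Nh n ∧ ¬ IsZero Nr n))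

/-- Placement. The placement of high-level and zero-level files is fixed (see `Caches`). The sub-files
of each low-level file are divided into `K` disjoint subsets of equal size `(K-1)/2`, one for each
user: `owner n s` is the only user that stores the sub-file `s` of the low-level file `n` (the values
of `owner` at other files are not used). -/
structure Placement (K N Nh Nr : ℕ) where
  owner : Fin N → Pair K → Fin K
  balanced : ∀ n, IsLow Nh Nr n → ∀ u : Fin K,
    (univ.filter fun s : Pair K => owner n s = u).card = (K - 1) / 2

variable {K N Nh Nr : ℕ}

/-- User `u` stores the sub-file `x`: for a high-level file if `u` belongs to the index of the
sub-file, for a low-level file if `u` is its owner, never for a zero-level file. -/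
def Placement.Caches (P : Placement K N Nh Nr) (u : Fin K) (x : SubFile K N) : Prop :=
  (IsHigh Nh x.1 ∧ u ∈ x.2.1) ∨ (IsLow Nh Nr x.1 ∧ P.owner x.1 x.2 = u)

instance (P : Placement K N Nh Nr) (u : Fin K) : DecidablePred (P.Caches u) :=
  fun x => inferInstanceAs (Decidable
    ((IsHigh Nh x.1 ∧ u ∈ x.2.1) ∨ (IsLow Nh Nr x.1 ∧ P.owner x.1 x.2 = u)))

/-- The set of sub-files stored by user `u`. -/
def Placement.cache (P : Placement K N Nh Nr) (u : Fin K) : Finset (SubFile K N) :=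
  univ.filter (P.Caches u)

/-- The normalized cache size of the scheme: `(Nh (t-1) + (N - Nr)) / K` with `t = 2`. -/
def cacheSize (K N Nh Nr : ℕ) : ℚ := ((Nh : ℚ) + ((N : ℚ) - (Nr : ℚ))) / (K : ℚ)

/-- High-level, low-level and zero-level users for the demand vector `d`. -/
def Kh (Nh : ℕ) (d : Fin K → Fin N) : Finset (Fin K) := univ.filter fun u => IsHigh Nh (d u)
def Kl (Nh Nr : ℕ) (d : Fin K → Fin N) : Finset (Fin K) := univ.filter fun u => IsLow Nh Nr (d u)
def Kr (Nr : ℕ) (d : Fin K → Fin N) : Finset (Fin K) := univ.filter fun u => IsZero Nr (d u)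

/-- `H_{i,j}`: the sub-files stored by user `i` of the (low-level) file requested by user `j`. -/
def setH (P : Placement K N Nh Nr) (d : Fin K → Fin N) (i j : Fin K) : Finset (Pair K) :=
  univ.filter fun s => P.owner (d j) s = i

/-- `L_{i,j}`: the sub-files requested by the high-level user `i` (so not stored by `i`) and stored
by the low-level user `j`. -/
def setL (i j : Fin K) : Finset (Pair K) := univ.filter fun s => i ∉ s.1 ∧ j ∈ s.1

/-- `Ω_{i,j}`: the members of `L_{i,j}` that are also stored by a high-level user. -/
def setOmega (Nh : ℕ) (d : Fin K → Fin N) (i j : Fin K) : Finset (Pair K) :=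
  (setL i j).filter fun s => ∃ k ∈ Kh Nh d, k ∈ s.1

/-- `Z_{i,j}`: the members of `L_{i,j}` that are also stored by a zero-level user. -/
def setZ (Nr : ℕ) (d : Fin K → Fin N) (i j : Fin K) : Finset (Pair K) :=
  (setL i j).filter fun s => ∃ r ∈ Kr Nr d, r ∈ s.1

/-- `Λ_i`: the sub-files requested by the high-level user `i` and stored by low-level users only.
As a set of indices it is the same for all `i`. -/
def setLambda (Nh Nr : ℕ) (d : Fin K → Fin N) : Finset (Pair K) :=
  univ.filter fun s => s.1 ⊆ Kl Nh Nr d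

/-- `σ_{i,j} = (|Λ_{i,j}| + |Z_{i,j}| - |H_{i,j}|)^+` (truncated subtraction). -/
def sigmaOf (lam z h : ℕ) : ℕ := lam + z - h

/-- `n_{i,j} = |Ω_{i,j}| - (|H_{i,j}| - |Λ_{i,j}| - |Z_{i,j}|)^+`, cut off at `0`. The cut-off matters
only for a single high-level user in the absence of zero-level users. -/
def nOf (om lam z h : ℕ) : ℕ := om - (h - (lam + z))

/-- All choices made by the delivery phase for the demand vector `d`. Sub-files requested by
a high-level user `i` are denoted by their index `s`, standing for `W_{d_i,s}`. -/
structure Delivery (P : Placement K N Nh Nr) (d : Fin K → Fin N) where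
  /-- Step 2: for low-level users `j < k`, a one-to-one correspondence of the sub-files wanted by `j`
  and stored by `k` with the sub-files wanted by `k` and stored by `j`. -/
  lowPair : Fin K → Fin K → Pair K → Pair K
  lowPair_bij : ∀ j ∈ Kl Nh Nr d, ∀ k ∈ Kl Nh Nr d, j < k →
    Set.BijOn (lowPair j k) (setH P d k j) (setH P d j k)
  /-- `Λ_{i,j}`: approximately uniform partition of `Λ_i`, the same one for all `i`. -/
  Lam : Fin K → Fin K → Finset (Pair K)
  Lam_subset : ∀ i ∈ Kh Nh d, ∀ j ∈ Kl Nh Nr d, Lam i j ⊆ setL i j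
  Lam_cover : ∀ i ∈ Kh Nh d, (Kl Nh Nr d).biUnion (Lam i) = setLambda Nh Nr d
  Lam_disjoint : ∀ i ∈ Kh Nh d, ∀ j ∈ Kl Nh Nr d, ∀ k ∈ Kl Nh Nr d, j ≠ k →
    Disjoint (Lam i j) (Lam i k)
  Lam_uniform : ∀ i ∈ Kh Nh d, ∀ j ∈ Kl Nh Nr d, ∀ k ∈ Kl Nh Nr d,
    (Lam i k).card ≤ (Lam i j).card + 1
  Lam_same : ∀ i ∈ Kh Nh d, ∀ i' ∈ Kh Nh d, ∀ j ∈ Kl Nh Nr d, Lam i j = Lam i' j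
  /-- `Π_{i,j}`: what is left of `Z_{i,j}` when `σ_{i,j}` sub-files are removed. -/
  Pi : Fin K → Fin K → Finset (Pair K)
  Pi_subset : ∀ i ∈ Kh Nh d, ∀ j ∈ Kl Nh Nr d, Pi i j ⊆ setZ Nr d i j
  Pi_card : ∀ i ∈ Kh Nh d, ∀ j ∈ Kl Nh Nr d, (setZ Nr d i j \ Pi i j).card =
    sigmaOf (Lam i j).card (setZ Nr d i j).card (setH P d i j).card
  /-- `Δ_{i,j}`: the `n_{i,j}` sub-files in `Ω_{i,j}` that are not used in cross-level messages. -/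
  Del : Fin K → Fin K → Finset (Pair K)
  Del_subset : ∀ i ∈ Kh Nh d, ∀ j ∈ Kl Nh Nr d, Del i j ⊆ setOmega Nh d i j
  Del_card : ∀ i ∈ Kh Nh d, ∀ j ∈ Kl Nh Nr d, (Del i j).card =
    nOf (setOmega Nh d i j).card (Lam i j).card (setZ Nr d i j).card (setH P d i j).card
  /-- Step 3: the members of `F_{i,j} = Λ_{i,j} ∪ Π_{i,j} ∪ (Ω_{i,j} \ Δ_{i,j})` are paired with
  distinct members of `H_{i,j}`. -/
  cross : Fin K → Fin K → Pair K → Pair K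
  cross_maps : ∀ i ∈ Kh Nh d, ∀ j ∈ Kl Nh Nr d,
    ∀ s ∈ Lam i j ∪ Pi i j ∪ (setOmega Nh d i j \ Del i j), cross i j s ∈ setH P d i j
  cross_inj : ∀ i ∈ Kh Nh d, ∀ j ∈ Kl Nh Nr d, Set.InjOn (cross i j)
    (Lam i j ∪ Pi i j ∪ (setOmega Nh d i j \ Del i j) : Finset (Pair K))
  /-- Step 4: the sub-files in all the sets `Δ_{i,j}`, tagged by the requesting user `i`, are divided
  into pairs of sub-files, and at most one single sub-file. The two sub-files of a pair are requested
  by two different high-level users, each of which stores what the other one requests. -/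
  B : Finpartition (univ.filter fun x : Fin K × Pair K =>
    x.1 ∈ Kh Nh d ∧ ∃ j ∈ Kl Nh Nr d, x.2 ∈ Del x.1 j)
  B_parts : ∀ p ∈ B.parts, p.card = 1 ∨
    ∃ i k : Fin K, ∃ s t : Pair K, i ≠ k ∧ i ∈ t.1 ∧ k ∈ s.1 ∧ p = {(i, s), (k, t)}
  B_single : (B.parts.filter fun p => p.card = 1).card ≤ 1

namespace Delivery

variable {P : Placement K N Nh Nr} {d : Fin K → Fin N} (D : Delivery P d)

/-- `F_{i,j}`. -/
def F (i j : Fin K) : Finset (Pair K) := D.Lam i j ∪ D.Pi i j ∪ (setOmega Nh d i j \ D.Del i j)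

/-- `σ_{i,j}`. -/
def sigma (i j : Fin K) : ℕ :=
  sigmaOf (D.Lam i j).card (setZ Nr d i j).card (setH P d i j).card

/-- `n_{i,j}`. -/
def n (i j : Fin K) : ℕ :=
  nOf (setOmega Nh d i j).card (D.Lam i j).card (setZ Nr d i j).card (setH P d i j).card

/-! The transmitted messages. For every step, a finite set that indexes the messages and, for
every index, the set of sub-files whose XOR is sent. -/

/-- Step 1: the 3-subsets of `K^h ∪ K^r` that are not contained in `K^r`. -/
def step1 (_D : Delivery P d) : Finset (Finset (Fin K)) :=
  (powersetCard 3 (Kh Nh d ∪ Kr Nr d)).filter fun S => ¬ S ⊆ Kr Nr d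

/-- The XOR of `W_{d_s, S \ {s}}` over the high-level users `s` in `S`. -/
def msg1 (_D : Delivery P d) (S : Finset (Fin K)) : Finset (SubFile K N) :=
  univ.filter fun x => ∃ s ∈ S, s ∈ Kh Nh d ∧ x.1 = d s ∧ x.2.1 = S.erase s

/-- Step 2: triples `(j, k, s)`, where `s` is wanted by `j` and stored by `k`. -/
def step2 (_D : Delivery P d) : Finset (Fin K × Fin K × Pair K) :=
  univ.filter fun x => x.1 ∈ Kl Nh Nr d ∧ x.2.1 ∈ Kl Nh Nr d ∧ x.1 < x.2.1 ∧
    x.2.2 ∈ setH P d x.2.1 x.1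

def msg2 (x : Fin K × Fin K × Pair K) : Finset (SubFile K N) :=
  {(d x.1, x.2.2), (d x.2.1, D.lowPair x.1 x.2.1 x.2.2)}

/-- Step 3: triples `(i, j, h)` with `i` high-level, `j` low-level and `h ∈ H_{i,j}`. -/
def step3 (_D : Delivery P d) : Finset (Fin K × Fin K × Pair K) :=
  univ.filter fun x => x.1 ∈ Kh Nh d ∧ x.2.1 ∈ Kl Nh Nr d ∧ x.2.2 ∈ setH P d x.1 x.2.1

/-- The XOR of `W_{d_j,h}` and of `W_{d_i,s}` for the `s ∈ F_{i,j}` that is paired with `h`. -/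
def msg3 (x : Fin K × Fin K × Pair K) : Finset (SubFile K N) :=
  insert (d x.2.1, x.2.2)
    (((D.F x.1 x.2.1).filter fun s => D.cross x.1 x.2.1 s = x.2.2).image fun s => (d x.1, s))

/-- Step 4: the parts of the partition `B`. -/
def step4 : Finset (Finset (Fin K × Pair K)) := D.B.parts

def msg4 (_D : Delivery P d) (p : Finset (Fin K × Pair K)) : Finset (SubFile K N) :=
  p.image fun x => (d x.1, x.2)

/-- Step 5, unicasts to low-level users `j` of the requested sub-files stored by zero-level users. -/
def step5low (_D : Delivery P d) : Finset (Fin K × Pair K) :=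
  univ.filter fun x => x.1 ∈ Kl Nh Nr d ∧ P.owner (d x.1) x.2 ∈ Kr Nr d

/-- Step 5, unicasts to high-level users `i` of the sub-files in `Z_{i,j} \ Π_{i,j}`. -/
def step5high : Finset (Fin K × Fin K × Pair K) :=
  univ.filter fun x => x.1 ∈ Kh Nh d ∧ x.2.1 ∈ Kl Nh Nr d ∧
    x.2.2 ∈ setZ Nr d x.1 x.2.1 \ D.Pi x.1 x.2.1

/-- Step 5, unicasts to zero-level users of all the sub-files of the requested files. -/
def step5zero (_D : Delivery P d) : Finset (Fin K × Pair K) :=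
  univ.filter fun x => x.1 ∈ Kr Nr d

/-- The index type of all the messages sent over the shared link. -/
abbrev Index : Type :=
  D.step1 ⊕ D.step2 ⊕ D.step3 ⊕ D.step4 ⊕ D.step5low ⊕ D.step5high ⊕ D.step5zero

/-- The set of sub-files whose XOR is the given message. -/
def msg : D.Index → Finset (SubFile K N)
  | .inl S => D.msg1 S
  | .inr (.inl x) => D.msg2 x
  | .inr (.inr (.inl x)) => D.msg3 x
  | .inr (.inr (.inr (.inl p))) => D.msg4 p
  | .inr (.inr (.inr (.inr (.inl x)))) => {(d x.1.1, x.1.2)}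
  | .inr (.inr (.inr (.inr (.inr (.inl x))))) => {(d x.1.1, x.1.2.2)}
  | .inr (.inr (.inr (.inr (.inr (.inr x))))) => {(d x.1.1, x.1.2)}

/-- The content of the messages for the library `W`. -/
def transmit {b : ℕ} (W : Library K N b) (m : D.Index) : Bits b :=
  ∑ x ∈ D.msg m, W x.1 x.2

/-- Every user can compute the requested file from the transmitted messages and the content of the
own cache, whatever the content of the library. -/
def Decodable (b : ℕ) : Prop :=
  ∀ u : Fin K, ∃ dec : (D.Index → Bits b) → (P.cache u → Bits b) → (Pair K → Bits b),
    ∀ W : Library K N b, dec (D.transmit W) (fun x => W x.1.1 x.1.2) = W (d u)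

/-- The delivery rate: the number of bits sent over the shared link, divided by the file size. -/
def rate (b : ℕ) : ℚ := ((Fintype.card D.Index * b : ℕ) : ℚ) / (fileSize K b : ℚ)

end Delivery

/-- `∑_{i,j} σ_{i,j}` as a function of `k = [kh, kl, kr]`. Of the `kl` sets `Λ_{i,j}`,
`⌈kl/2⌉` have `⌊(kl-1)/2⌋` elements and `⌊kl/2⌋` have `⌈(kl-1)/2⌉ = ⌊kl/2⌋` elements
(all have `(kl-1)/2` elements if `kl` is odd); moreover `|Z| = kr` and `|H| = (K-1)/2`. -/
def sigmaSum (K kh kl kr : ℕ) : ℕ :=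
  kh * ((kl - kl / 2) * sigmaOf ((kl - 1) / 2) kr ((K - 1) / 2) +
    (kl / 2) * sigmaOf (kl / 2) kr ((K - 1) / 2))

/-- `∑_{i,j} n_{i,j}` as a function of `k = [kh, kl, kr]`, with `|Ω| = kh - 1`. -/
def nSum (K kh kl kr : ℕ) : ℕ :=
  kh * ((kl - kl / 2) * nOf (kh - 1) ((kl - 1) / 2) kr ((K - 1) / 2) +
    (kl / 2) * nOf (kh - 1) (kl / 2) kr ((K - 1) / 2))

/-- The number `N_T(k)` of messages, where the unicasts to zero-level users are not counted. -/
def NT (K kh kl kr : ℕ) : ℕ :=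
  ((kh + kr).choose 3 - kr.choose 3) + (K - 1) / 2 * kl.choose 2 + (K - 1) / 2 * (kh * kl) +
    ⌈(nSum K kh kl kr : ℚ) / 2⌉₊ + (kl * kr * ((K - 1) / 2) + sigmaSum K kh kl kr)

end CL210

/-!
Every message and every cached sub-file depends linearly on the library, so a user can decode as
soon as the requested sub-files vanish in each library in which the messages and the cache vanish.
This holds because in a message useful to a user all the other summands are stored by that user.

The sets `Λ_{i,j}`, `j ∈ Kˡ`, have `C(kˡ, 2)` elements altogether and cardinalities differing by
at most one, which determines how often each cardinality occurs; hence the sums of `σ` and `n`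
depend on `k` only. Such sets come from an equitable tournament on the low-level users.

The delicate choice is that of the sets `Δ_{i,j}` in Step 4. The sub-file `W_{d_i,{k,j}}` is an arc
from `i` to `k` on the high-level users, and two opposite arcs can be combined in one message. For
fixed `j` the arcs must form a digraph of prescribed out-degree. For even out-degree a symmetric
circulant graph will do. For odd out-degree one more step of length about half the number of users
is needed; two such digraphs with steps of opposite sign cancel, and a last one is chosen symmetric
but for one arc.
-/

namespace CL210

section EquitableFamilies

theorem card_filter_eq_div_add_one_of_equitableOn {ι : Type*} {A : Finset ι} {f : ι → ℕ}
    (hf : (A : Set ι).EquitableOn f) :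
    (A.filter fun a => f a = (∑ a ∈ A, f a) / A.card + 1).card = (∑ a ∈ A, f a) % A.card := by
  set q := (∑ a ∈ A, f a) / A.card with hq
  have total : ∑ a ∈ A, f a = A.card * q + (A.filter fun a => f a = q + 1).card := by
    rw [card_filter, ← smul_eq_mul, ← sum_const, ← sum_add_distrib]
    refine sum_congr rfl fun a ha => ?_
    rcases equitableOn_iff.1 hf a ha with h | h <;> rw [← hq] at h <;> simp [h]
  have div_mod := Nat.div_add_mod (∑ a ∈ A, f a) A.card
  rw [← hq] at div_mod
  linarith

theorem sum_comp_of_equitableOn {ι M : Type*} [AddCommMonoid M] {A : Finset ι} {f : ι → ℕ}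
    (hf : (A : Set ι).EquitableOn f) (g : ℕ → M) :
    ∑ a ∈ A, g (f a) =
      (A.card - (∑ a ∈ A, f a) % A.card) • g ((∑ a ∈ A, f a) / A.card) +
        ((∑ a ∈ A, f a) % A.card) • g ((∑ a ∈ A, f a) / A.card + 1) := by
  have upper := card_filter_eq_div_add_one_of_equitableOn hf
  have split := card_filter_add_card_filter_not (s := A)
    fun a => f a = (∑ a ∈ A, f a) / A.card + 1
  rw [upper] at split
  rw [← Nat.eq_sub_of_add_eq' split, ← upper, ← sum_const, ← sum_const, add_comm,
    ← sum_filter_add_sum_filter_not A (fun a => f a = (∑ a ∈ A, f a) / A.card + 1)]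
  congr 1 <;> refine sum_congr rfl fun a ha => ?_
  · rw [(mem_filter.1 ha).2]
  · rw [(equitableOn_iff.1 hf a (mem_filter.1 ha).1).resolve_right (mem_filter.1 ha).2]

theorem choose_two_of_odd {n : ℕ} (hn : Odd n) : n.choose 2 = n * ((n - 1) / 2) := by
  obtain ⟨m, rfl⟩ := hn
  rw [Nat.choose_two_right, Nat.mul_div_assoc _ ⟨m, by omega⟩]

theorem sum_comp_of_sum_eq_choose_two {ι M : Type*} [AddCommMonoid M] {A : Finset ι} {f : ι → ℕ}
    (hf : (A : Set ι).EquitableOn f) (hsum : ∑ a ∈ A, f a = A.card.choose 2) (g : ℕ → M) :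
    ∑ a ∈ A, g (f a) =
      (A.card - A.card / 2) • g ((A.card - 1) / 2) + (A.card / 2) • g (A.card / 2) := by
  rw [sum_comp_of_equitableOn hf, hsum]
  rcases Nat.even_or_odd' A.card with ⟨_ | c, hc | hc⟩
  · simp [hc]
  · simp [hc]
  · have choose_eq : (2 * (c + 1)).choose 2 = c + 1 + 2 * (c + 1) * c := by
      rw [Nat.choose_two_right, mul_assoc, Nat.mul_div_cancel_left _ two_pos,
        show 2 * (c + 1) - 1 = 2 * c + 1 by omega]
      ring
    rw [hc, choose_eq, Nat.add_mul_mod_self_left, Nat.add_mul_div_left _ _ (by omega),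
      Nat.mod_eq_of_lt (by omega), Nat.div_eq_of_lt (by omega), zero_add,
      show (2 * (c + 1) - 1) / 2 = c by omega, show 2 * (c + 1) / 2 = c + 1 by omega]
  · rw [hc, choose_two_of_odd (odd_two_mul_add_one _), Nat.mul_mod_right,
      Nat.mul_div_cancel_left _ (by omega), show (2 * (c + 1) + 1) / 2 = c + 1 by omega,
      Nat.add_sub_cancel, Nat.mul_div_cancel_left _ two_pos, zero_nsmul, add_zero, ← add_nsmul,
      tsub_zero, Nat.sub_add_cancel (by omega)]

theorem eq_or_eq_of_sum_eq_choose_two {ι : Type*} {A : Finset ι} {f : ι → ℕ}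
    (hf : (A : Set ι).EquitableOn f) (hsum : ∑ a ∈ A, f a = A.card.choose 2) {a : ι}
    (ha : a ∈ A) : f a = (A.card - 1) / 2 ∨ f a = A.card / 2 := by
  have indicator := sum_comp_of_sum_eq_choose_two hf hsum
    fun x => if x = (A.card - 1) / 2 ∨ x = A.card / 2 then 0 else 1
  by_contra h
  simpa [h] using sum_eq_zero_iff.1 (indicator.trans (by simp)) a ha

end EquitableFamilies

section Counting

theorem card_eq_sum_of_mem_iff {α γ : Type*} {A : Finset α} {S : α → Finset γ}
    {T : Finset (α × γ)} (hT : ∀ a c, (a, c) ∈ T ↔ a ∈ A ∧ c ∈ S a) :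
    T.card = ∑ a ∈ A, (S a).card := by
  rw [← card_sigma]
  exact card_equiv (Equiv.sigmaEquivProd α γ).symm fun x => by simp [hT x.1 x.2]

theorem card_eq_sum_sum_of_mem_iff {α β γ : Type*} {A : Finset α} {B : α → Finset β}
    {S : α → β → Finset γ} {T : Finset (α × β × γ)}
    (hT : ∀ a b c, (a, b, c) ∈ T ↔ a ∈ A ∧ b ∈ B a ∧ c ∈ S a b) :
    T.card = ∑ a ∈ A, ∑ b ∈ B a, (S a b).card := by
  rw [card_eq_sum_of_mem_iff (A := A) (S := fun a => ((B a).sigma (S a)).map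
    (Equiv.sigmaEquivProd β γ).toEmbedding)]
  · simp only [card_map, card_sigma]
  · simp [hT, mem_map_equiv]

theorem card_parts_eq_ceil_half {α : Type*} [DecidableEq α] {X : Finset α}
    (B : Finpartition X) (small : ∀ p ∈ B.parts, p.card = 1 ∨ p.card = 2)
    (single : (B.parts.filter fun p => p.card = 1).card ≤ 1) :
    B.parts.card = ⌈(X.card : ℚ) / 2⌉₊ := by
  have total : X.card + (B.parts.filter fun p => p.card = 1).card = 2 * B.parts.card := by
    rw [← B.sum_card_parts, card_filter, ← sum_add_distrib, mul_comm]
    refine sum_const_nat fun p hp => ?_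
    rcases small p hp with h | h <;> simp [h]
  have total' : (X.card : ℚ) + (B.parts.filter fun p => p.card = 1).card = 2 * B.parts.card := by
    exact_mod_cast total
  have single' : ((B.parts.filter fun p => p.card = 1).card : ℚ) ≤ 1 := by exact_mod_cast single
  refine le_antisymm (Nat.lt_add_one_iff.1 ?_) (Nat.ceil_le.2 (by linarith))
  have : (B.parts.card : ℚ) < ⌈(X.card : ℚ) / 2⌉₊ + 1 := by
    linarith [Nat.le_ceil ((X.card : ℚ) / 2)]
  exact_mod_cast this

end Counting

section Matchings

theorem exists_injOn_of_card_le {α β : Type*} [Nonempty β] {A : Finset α} {B : Finset β}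
    (h : A.card ≤ B.card) : ∃ φ : α → β, Set.MapsTo φ A B ∧ Set.InjOn φ A :=
  Set.Finite.exists_injOn_of_encard_le (t := (B : Set β)) A.finite_toSet (by simpa using h)

theorem exists_bijOn_of_card_eq {α β : Type*} [Nonempty β] {A : Finset α} {B : Finset β}
    (h : A.card = B.card) : ∃ φ : α → β, Set.BijOn φ A B :=
  A.finite_toSet.exists_bijOn_of_encard_eq (by simp only [Set.encard_coe_eq_coe_finsetCard, h])

theorem card_filter_mem_of_bijOn {α β : Type*} [DecidableEq β] {A : Finset α} {B C : Finset β}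
    {φ : α → β} (hφ : Set.BijOn φ A B) (hC : C ⊆ B) :
    (A.filter fun a => φ a ∈ C).card = C.card := by
  refine card_nbij φ (fun a ha => (mem_filter.1 ha).2)
    (hφ.injOn.mono fun a ha => (mem_filter.1 ha).1) fun c hc => ?_
  obtain ⟨a, ha, rfl⟩ := hφ.surjOn (hC hc)
  exact ⟨a, mem_filter.2 ⟨ha, hc⟩, rfl⟩

theorem card_filter_eq_card_filter_sdiff_add {α : Type*} [DecidableEq α] {p X : Finset α}
    (hp : p ⊆ X) (q : α → Prop) [DecidablePred q] :
    (X.filter q).card = ((X \ p).filter q).card + (p.filter q).card := by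
  rw [← card_union_of_disjoint (disjoint_filter_filter sdiff_disjoint), ← filter_union,
    sdiff_union_of_subset hp]

theorem card_filter_sdiff_pair_le {α γ : Type*} [DecidableEq α] [DecidableEq γ] {τ : γ → γ}
    (hτ : Function.Involutive τ) {f : α → γ} {X : Finset α} {excess : Finset γ} {x y : α}
    (hxy : x ≠ y) (hp : {x, y} ⊆ X) (hfy : f y = τ (f x))
    (hX : ∀ g, (X.filter (f · = g)).card ≤
      (X.filter (f · = τ g)).card + if g ∈ excess then 1 else 0) (g : γ) :
    ((X \ {x, y}).filter (f · = g)).card ≤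
      ((X \ {x, y}).filter (f · = τ g)).card + if g ∈ excess then 1 else 0 := by
  have symm : (filter (f · = g) {x, y}).card = (filter (f · = τ g) {x, y}).card := by
    have hx : f x = g ↔ f y = τ g := by rw [hfy, hτ.injective.eq_iff]
    have hy : f y = g ↔ f x = τ g := by rw [hfy, hτ.eq_iff]
    rw [card_filter, card_filter, sum_pair hxy, sum_pair hxy, add_comm]
    simp only [hx, hy]
  have bound := hX g
  rw [card_filter_eq_card_filter_sdiff_add hp,
    card_filter_eq_card_filter_sdiff_add hp (f · = τ g)] at bound
  omega

theorem card_filter_sdiff_singleton_le {α γ : Type*} [DecidableEq α] [DecidableEq γ] {τ : γ → γ}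
    (hτ : Function.Involutive τ) {f : α → γ} {X : Finset α} {excess : Finset γ} {x : α}
    (hx : x ∈ X) (partner : ¬ ∃ y ∈ X, f y = τ (f x))
    (hX : ∀ g, (X.filter (f · = g)).card ≤
      (X.filter (f · = τ g)).card + if g ∈ excess then 1 else 0) :
    f x ∈ excess ∧ ∀ g, ((X \ {x}).filter (f · = g)).card ≤
      ((X \ {x}).filter (f · = τ g)).card + if g ∈ excess.erase (f x) then 1 else 0 := by
  have no_partner : (X.filter (f · = τ (f x))).card = 0 :=
    card_eq_zero.2 (filter_eq_empty_iff.2 fun y hy h => partner ⟨y, hy, h⟩)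
  have count (g : γ) : (X.filter (f · = g)).card =
      ((X \ {x}).filter (f · = g)).card + if f x = g then 1 else 0 := by
    rw [card_filter_eq_card_filter_sdiff_add (singleton_subset_iff.2 hx), card_filter _ {x},
      sum_singleton]
  have bound := hX (f x)
  rw [no_partner, count, if_pos rfl] at bound
  have mem_excess : f x ∈ excess := by
    by_contra h
    rw [if_neg h] at bound
    omega
  refine ⟨mem_excess, fun g => ?_⟩
  rcases eq_or_ne (f x) g with rfl | hg
  · rw [if_pos mem_excess] at bound
    omega
  · have bound := hX g
    rcases eq_or_ne (f x) (τ g) with h | h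
    · rw [h, hτ g, count] at no_partner
      omega
    · rw [count, if_neg hg, count (τ g), if_neg h] at bound
      simpa [hg.symm] using bound

/-- The elements are paired greedily. Each step keeps the hypothesis, as it removes an element of
type `τ g` along with one of type `g`, unless there is no element of type `τ g`. -/
theorem exists_finpartition_pairs {α γ : Type*} [DecidableEq α] [DecidableEq γ] {τ : γ → γ}
    (hτ : Function.Involutive τ) (f : α → γ) (X : Finset α) (hf : ∀ x ∈ X, τ (f x) ≠ f x)
    (excess : Finset γ)
    (hX : ∀ g, (X.filter (f · = g)).card ≤
      (X.filter (f · = τ g)).card + if g ∈ excess then 1 else 0) :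
    ∃ B : Finpartition X,
      (∀ p ∈ B.parts, p.card = 1 ∨ ∃ x ∈ X, ∃ y ∈ X, f y = τ (f x) ∧ p = {x, y}) ∧
      (B.parts.filter fun p => p.card = 1).card ≤ excess.card := by
  induction X using Finset.strongInduction generalizing excess with
  | H X ih =>
  rcases X.eq_empty_or_nonempty with rfl | ⟨x, hx⟩
  · exact ⟨Finpartition.empty _, by simp, by simp⟩
  by_cases partner : ∃ y ∈ X, f y = τ (f x)
  · obtain ⟨y, hy, hfy⟩ := partner
    have hxy : x ≠ y := fun h => hf x hx (hfy.symm.trans (congrArg f h.symm))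
    have hp : {x, y} ⊆ X := insert_subset hx (singleton_subset_iff.2 hy)
    obtain ⟨B, hB, hsingle⟩ := ih (X \ {x, y}) (sdiff_ssubset hp (insert_nonempty x _))
      (fun z hz => hf z (mem_sdiff.1 hz).1) excess
      (card_filter_sdiff_pair_le hτ hxy hp hfy hX)
    refine ⟨B.extend (insert_ne_empty x _) sdiff_disjoint (sdiff_union_of_subset hp), ?_, ?_⟩
    · refine (forall_mem_insert _ _ _).2 ⟨.inr ⟨x, hx, y, hy, hfy, rfl⟩, fun p hpB => ?_⟩
      refine (hB p hpB).imp_right ?_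
      rintro ⟨z, hz, w, hw, hzw⟩
      exact ⟨z, sdiff_subset hz, w, sdiff_subset hw, hzw⟩
    · rwa [Finpartition.extend, filter_insert, if_neg (by rw [card_pair hxy]; norm_num)]
  · obtain ⟨mem_excess, hX'⟩ := card_filter_sdiff_singleton_le hτ hx partner hX
    have hp : {x} ⊆ X := singleton_subset_iff.2 hx
    obtain ⟨B, hB, hsingle⟩ := ih (X \ {x}) (sdiff_ssubset hp (singleton_nonempty x))
      (fun z hz => hf z (mem_sdiff.1 hz).1) (excess.erase (f x)) hX'
    refine ⟨B.extend (singleton_ne_empty x) sdiff_disjoint (sdiff_union_of_subset hp), ?_, ?_⟩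
    · refine (forall_mem_insert _ _ _).2 ⟨.inl (card_singleton x), fun p hpB => ?_⟩
      refine (hB p hpB).imp_right ?_
      rintro ⟨z, hz, w, hw, hzw⟩
      exact ⟨z, sdiff_subset hz, w, sdiff_subset hw, hzw⟩
    · rw [Finpartition.extend, filter_insert, if_pos (card_singleton x)]
      refine (card_insert_le _ _).trans ?_
      rw [← card_erase_add_one mem_excess]
      exact Nat.add_le_add_right hsingle 1

end Matchings

section Tournament

/-- The vertices of `{0, …, k - 1}` beaten by `a` in the tournament in which, for `a < c`, the
winner is `a` if `a + c` is odd and `c` otherwise. -/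
def parityTournament (k a : ℕ) : Finset ℕ :=
  (range (a / 2)).image (fun t => a - 2 * (t + 1)) ∪
    (range ((k - a) / 2)).image fun t => a + 2 * t + 1

theorem mem_parityTournament {k a c : ℕ} :
    c ∈ parityTournament k a ↔
      c < a ∧ c % 2 = a % 2 ∨ a < c ∧ c < k ∧ c % 2 ≠ a % 2 := by
  simp only [parityTournament, mem_union, mem_image, mem_range]
  constructor
  · rintro (⟨t, ht, rfl⟩ | ⟨t, ht, rfl⟩) <;> omega
  · rintro (h | h)
    · exact .inl ⟨(a - c) / 2 - 1, by omega, by omega⟩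
    · exact .inr ⟨(c - a) / 2, by omega, by omega⟩

theorem card_parityTournament (k a : ℕ) :
    (parityTournament k a).card = a / 2 + (k - a) / 2 := by
  rw [parityTournament, card_union_of_disjoint, card_image_of_injOn, card_image_of_injective,
    card_range, card_range]
  · intro t t' h
    simp only at h
    omega
  · simp only [Set.InjOn, coe_range, Set.mem_Iio]
    intro t ht t' ht' h
    omega
  · simp only [disjoint_left, mem_image, mem_range]
    rintro _ ⟨t, ht, rfl⟩ ⟨t', -, h⟩
    omega

theorem exists_equitable_tournament {α : Type*} [DecidableEq α] (A : Finset α) :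
    ∃ T : α → Finset α, (∀ a ∈ A, T a ⊆ A.erase a) ∧
      (∀ a ∈ A, ∀ c ∈ A, a ≠ c → (c ∈ T a ↔ a ∉ T c)) ∧
      (A : Set α).EquitableOn fun a => (T a).card := by
  obtain ⟨φ, hφ⟩ := exists_bijOn_of_card_eq (card_range A.card).symm
  have card_wins {a : α} (ha : a ∈ A) :
      (A.filter fun c => φ c ∈ parityTournament A.card (φ a)).card =
        φ a / 2 + (A.card - φ a) / 2 := by
    rw [card_filter_mem_of_bijOn hφ fun c hc => ?_, card_parityTournament]
    have := mem_range.1 (hφ.mapsTo ha)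
    rw [mem_range]
    rw [mem_parityTournament] at hc
    omega
  refine ⟨fun a => A.filter fun c => φ c ∈ parityTournament A.card (φ a), fun a _ c hc => ?_,
    fun a ha c hc hac => ?_, fun a c ha hc => ?_⟩
  · simp only [mem_filter, mem_parityTournament] at hc
    refine mem_erase.2 ⟨?_, hc.1⟩
    rintro rfl
    omega
  · have := mem_range.1 (hφ.mapsTo ha)
    have := mem_range.1 (hφ.mapsTo hc)
    have := hφ.injOn.ne ha hc hac
    simp only [mem_filter, mem_parityTournament, ha, hc, true_and]
    omega
  · have := mem_range.1 (hφ.mapsTo ha)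
    have := mem_range.1 (hφ.mapsTo hc)
    simp only [card_wins ha, card_wins hc]
    omega

end Tournament

section NearRegular

variable {m : ℕ}

theorem intCast_zmod_inj_of_abs_sub_lt {x y : ℤ} (h : |y - x| < m) :
    (x : ZMod m) = y ↔ x = y := by
  refine ⟨fun hxy => ?_, congrArg _⟩
  have := Int.eq_zero_of_abs_lt_dvd ((ZMod.intCast_eq_intCast_iff_dvd_sub x y m).1 hxy) h
  omega

/-- The steps `±1, …, ±r` of a circulant graph on `ZMod m`. -/
noncomputable def circulantSteps (m r : ℕ) : Finset (ZMod m) := ((Icc (-r : ℤ) r).erase 0).image (↑)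

theorem mem_circulantSteps {r : ℕ} {s : ZMod m} :
    s ∈ circulantSteps m r ↔ ∃ x : ℤ, x ≠ 0 ∧ |x| ≤ r ∧ (x : ZMod m) = s := by
  simp [circulantSteps, abs_le, and_assoc]

theorem neg_mem_circulantSteps {r : ℕ} {s : ZMod m} :
    -s ∈ circulantSteps m r ↔ s ∈ circulantSteps m r := by
  have of_mem {s : ZMod m} (hs : s ∈ circulantSteps m r) : -s ∈ circulantSteps m r := by
    obtain ⟨x, hx, hxr, rfl⟩ := mem_circulantSteps.1 hs
    exact mem_circulantSteps.2 ⟨-x, neg_ne_zero.2 hx, by rwa [abs_neg], Int.cast_neg x⟩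
  exact ⟨fun h => neg_neg s ▸ of_mem h, of_mem⟩

theorem card_circulantSteps {r : ℕ} (hr : 2 * r < m) : (circulantSteps m r).card = 2 * r := by
  rw [circulantSteps, card_image_of_injOn, card_erase_of_mem (by simp), Int.card_Icc]
  · omega
  · intro x hx y hy hxy
    simp only [coe_erase, coe_Icc, Set.mem_sdiff, Set.mem_Icc] at hx hy
    exact (intCast_zmod_inj_of_abs_sub_lt (abs_lt.2 (by omega))).1 hxy

theorem intCast_notMem_circulantSteps {r : ℕ} {x : ℤ} (hx : x = 0 ∨ r < |x|) (hm : |x| + r < m) :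
    (x : ZMod m) ∉ circulantSteps m r := by
  intro h
  obtain ⟨y, hy, hyr, hyx⟩ := mem_circulantSteps.1 h
  rw [intCast_zmod_inj_of_abs_sub_lt ((abs_sub x y).trans_lt (by linarith))] at hyx
  subst hyx
  omega

/-- The steps `±⌊m / 2⌋`. -/
def IsHalfStep (s : ZMod m) : Prop := s = (m / 2 : ℕ) ∨ s = -(m / 2 : ℕ)

theorem IsHalfStep.notMem_circulantSteps {s : ZMod m} (hs : IsHalfStep s) {r : ℕ}
    (hr : r < m / 2) : s ∉ circulantSteps m r := by
  have half_notMem : ((m / 2 : ℕ) : ZMod m) ∉ circulantSteps m r := by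
    rw [← Int.cast_natCast]
    exact intCast_notMem_circulantSteps (.inr (by rw [Nat.abs_cast]; omega))
      (by rw [Nat.abs_cast]; omega)
  rcases hs with rfl | rfl
  · exact half_notMem
  · exact neg_mem_circulantSteps.not.2 half_notMem

theorem IsHalfStep.ne_zero {s : ZMod m} (hs : IsHalfStep s) (hm : 1 < m) : s ≠ 0 := by
  have half_ne_zero : ((m / 2 : ℕ) : ZMod m) ≠ 0 := fun h =>
    absurd (Nat.le_of_dvd (by omega) ((ZMod.natCast_eq_zero_iff _ _).1 h)) (by omega)
  rcases hs with rfl | rfl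
  · exact half_ne_zero
  · exact neg_ne_zero.2 half_ne_zero

/-- The step of length `⌊m / 2⌋` which for even `m` leads to the antipode. For odd `m` it matches
all residues except `-1` in pairs. -/
def antipodalStep (a : ZMod m) : ZMod m :=
  if a.val < m / 2 then (m / 2 : ℕ) else -(m / 2 : ℕ)

theorem isHalfStep_antipodalStep (a : ZMod m) : IsHalfStep (antipodalStep a) := by
  unfold antipodalStep
  split_ifs
  · exact .inl rfl
  · exact .inr rfl

theorem antipodalStep_involutive [NeZero m] {a : ZMod m} (ha : a ≠ (m - 1 : ℕ)) :
    a + antipodalStep a + antipodalStep (a + antipodalStep a) = a := by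
  have val_half : ((m / 2 : ℕ) : ZMod m).val = m / 2 :=
    ZMod.val_natCast_of_lt (Nat.div_lt_self (NeZero.pos m) one_lt_two)
  have a_lt := a.val_lt
  have a_ne : a.val ≠ m - 1 := fun h => ha (by rw [← h, ZMod.natCast_zmod_val])
  by_cases h : a.val < m / 2
  · have val_add : (a + (m / 2 : ℕ)).val = a.val + m / 2 := by
      rw [ZMod.val_add_of_lt (by omega), val_half]
    rw [antipodalStep, if_pos h, antipodalStep, if_neg (by omega), add_neg_cancel_right]
  · have val_sub : (a + -(m / 2 : ℕ)).val = a.val - m / 2 := by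
      rw [← sub_eq_add_neg, ZMod.val_sub (by omega), val_half]
    rw [antipodalStep, if_neg h, antipodalStep, if_pos (by omega), neg_add_cancel_right]

/-- The out-neighbours of `a` in a digraph of out-degree `n`: a circulant graph, and for odd `n` one
further step of length `⌊m / 2⌋`, whose sign is chosen by `e`. -/
noncomputable def circulantNeighbors (n : ℕ) (e : ZMod m → ZMod m) (a : ZMod m) : Finset (ZMod m) :=
  (circulantSteps m (n / 2)).image (a + ·) ∪ if Odd n then {a + e a} else ∅

theorem mem_circulantNeighbors {n : ℕ} {e : ZMod m → ZMod m} {a c : ZMod m} :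
    c ∈ circulantNeighbors n e a ↔
      c - a ∈ circulantSteps m (n / 2) ∨ Odd n ∧ a + e a = c := by
  have translate : c ∈ (circulantSteps m (n / 2)).image (a + ·) ↔
      c - a ∈ circulantSteps m (n / 2) := by
    simp [sub_eq_neg_add]
  rw [circulantNeighbors, mem_union, translate]
  split_ifs with h <;> simp [h, eq_comm]

theorem IsHalfStep.notMem_circulantSteps_of_odd {n : ℕ} (hn : n < m) (odd : Odd n) {s : ZMod m}
    (hs : IsHalfStep s) : s ∉ circulantSteps m (n / 2) := by
  obtain ⟨r, rfl⟩ := odd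
  exact hs.notMem_circulantSteps (by omega)

theorem card_circulantNeighbors {n : ℕ} (hn : n < m) {e : ZMod m → ZMod m} {a : ZMod m}
    (he : IsHalfStep (e a)) : (circulantNeighbors n e a).card = n := by
  have card_circulant : ((circulantSteps m (n / 2)).image (a + ·)).card = 2 * (n / 2) := by
    rw [card_image_of_injective _ (add_right_injective a), card_circulantSteps (by omega)]
  rw [circulantNeighbors]
  split_ifs with odd
  · have : a + e a ∉ (circulantSteps m (n / 2)).image (a + ·) := by
      simpa using he.notMem_circulantSteps_of_odd hn odd
    rw [union_comm, ← insert_eq, card_insert_of_notMem this, card_circulant,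
      Nat.two_mul_div_two_add_one_of_odd odd]
  · rw [union_empty, card_circulant, Nat.two_mul_div_two_of_even (Nat.not_odd_iff_even.1 odd)]

theorem notMem_circulantNeighbors_self {n : ℕ} (hn : n < m) {e : ZMod m → ZMod m} {a : ZMod m}
    (he : IsHalfStep (e a)) : a ∉ circulantNeighbors n e a := by
  rw [mem_circulantNeighbors, sub_self, add_eq_left, not_or, not_and]
  refine ⟨?_, fun odd => he.ne_zero (by have := odd.pos; omega)⟩
  exact_mod_cast intCast_notMem_circulantSteps (x := 0) (.inl rfl) (by simp; omega)

theorem card_filter_mem_circulantNeighbors {ι : Type*} {L : Finset ι} {deg : ι → ℕ}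
    (hdeg : ∀ j ∈ L, deg j < m) {e : ι → ZMod m → ZMod m} (he : ∀ j a, IsHalfStep (e j a))
    (a c : ZMod m) :
    (L.filter fun j => c ∈ circulantNeighbors (deg j) (e j) a).card =
      (L.filter fun j => c - a ∈ circulantSteps m (deg j / 2)).card +
        ((L.filter fun j => Odd (deg j)).filter fun j => a + e j a = c).card := by
  classical
  simp only [mem_circulantNeighbors]
  rw [filter_or, filter_filter, card_union_of_disjoint]
  refine disjoint_filter.2 fun j hj hs ⟨odd, hc⟩ => ?_
  rw [← hc, add_sub_cancel_left] at hs
  exact (he j a).notMem_circulantSteps_of_odd (hdeg j hj) odd hs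

theorem exists_halfSteps_card_eq {ι : Type*} (O : Finset ι) :
    ∃ e : ι → ZMod m → ZMod m, (∀ j a, IsHalfStep (e j a)) ∧
      ∀ a c, (O.filter fun j => a + e j a = c).card =
        (if a + antipodalStep a = c then O.card % 2 else 0) +
          (if a + -(m / 2 : ℕ) = c then O.card / 2 else 0) +
          (if a + (m / 2 : ℕ) = c then O.card / 2 else 0) := by
  classical
  obtain ⟨O₁, hO₁, card₁⟩ := exists_subset_card_eq (Nat.div_le_self O.card 2)
  obtain ⟨O₂, hO₂, card₂⟩ := exists_subset_card_eq (s := O \ O₁) (n := O.card / 2)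
    (by rw [card_sdiff_of_subset hO₁]; omega)
  have card₃ : ((O \ O₁) \ O₂).card = O.card % 2 := by
    rw [card_sdiff_of_subset hO₂, card_sdiff_of_subset hO₁]
    omega
  let e (j : ι) (a : ZMod m) : ZMod m :=
    if j ∈ O₁ then (m / 2 : ℕ) else if j ∈ O₂ then -(m / 2 : ℕ) else antipodalStep a
  refine ⟨e, fun j a => ?_, fun a c => ?_⟩
  · simp only [e]
    split_ifs
    · exact .inl rfl
    · exact .inr rfl
    · exact isHalfStep_antipodalStep a
  · rw [card_filter_eq_card_filter_sdiff_add hO₁, card_filter_eq_card_filter_sdiff_add hO₂,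
      filter_congr (s := O₁) (q := fun _ => a + (m / 2 : ℕ) = c),
      filter_congr (s := O₂) (q := fun _ => a + -(m / 2 : ℕ) = c),
      filter_congr (s := (O \ O₁) \ O₂) (q := fun _ => a + antipodalStep a = c)]
    · simp only [filter_const, apply_ite card, card_empty, card₁, card₂, card₃]
    · intro j hj
      simp only [mem_sdiff] at hj
      simp only [e, hj.1.2, hj.2, if_false]
    · intro j hj
      simp only [e, (mem_sdiff.1 (hO₂ hj)).2, hj, if_false, if_true]
    · intro j hj
      simp only [e, hj, if_true]

/-- A step `⌊m / 2⌋` at one member of `O` cancels the step `-⌊m / 2⌋` at another one. At most one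
member is left over; the antipodal step at that one is symmetric except at `-1`. -/
theorem exists_halfSteps [NeZero m] {ι : Type*} (O : Finset ι) :
    ∃ e : ι → ZMod m → ZMod m, (∀ j a, IsHalfStep (e j a)) ∧
      ∃ g, ∀ a c, (O.filter fun j => a + e j a = c).card ≤
        (O.filter fun j => c + e j c = a).card + if (a, c) = g then 1 else 0 := by
  obtain ⟨e, he, count⟩ := exists_halfSteps_card_eq (m := m) O
  refine ⟨e, he, ((m - 1 : ℕ), ((m - 1 : ℕ) : ZMod m) + antipodalStep ((m - 1 : ℕ))),
    fun a c => ?_⟩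
  have plus : a + (m / 2 : ℕ) = c ↔ c + -(m / 2 : ℕ) = a := by
    rw [← sub_eq_add_neg, sub_eq_iff_eq_add, eq_comm]
  have minus : a + -(m / 2 : ℕ) = c ↔ c + (m / 2 : ℕ) = a := by
    rw [← sub_eq_add_neg, sub_eq_iff_eq_add, eq_comm]
  rw [count, count]
  simp only [plus, minus]
  by_cases hc : a + antipodalStep a = c
  · by_cases ha : a = (m - 1 : ℕ)
    · rw [if_pos (Prod.ext ha (by rw [← hc, ha]))]
      split_ifs <;> omega
    · have back : c + antipodalStep c = a := hc ▸ antipodalStep_involutive ha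
      rw [if_pos hc, if_pos back]
      omega
  · rw [if_neg hc]
    omega

theorem exists_outNeighbors_zmod [NeZero m] {ι : Type*} (L : Finset ι) (deg : ι → ℕ)
    (hdeg : ∀ j ∈ L, deg j < m) :
    ∃ T : ι → ZMod m → Finset (ZMod m), (∀ j ∈ L, ∀ a, a ∉ T j a ∧ (T j a).card = deg j) ∧
      ∃ g, ∀ a c, (L.filter fun j => c ∈ T j a).card ≤
        (L.filter fun j => a ∈ T j c).card + if (a, c) = g then 1 else 0 := by
  obtain ⟨e, he, g, hg⟩ := exists_halfSteps (m := m) (L.filter fun j => Odd (deg j))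
  refine ⟨fun j => circulantNeighbors (deg j) (e j), fun j hj a =>
    ⟨notMem_circulantNeighbors_self (hdeg j hj) (he j a),
      card_circulantNeighbors (hdeg j hj) (he j a)⟩, g, fun a c => ?_⟩
  have symm (j : ι) : c - a ∈ circulantSteps m (deg j / 2) ↔
      a - c ∈ circulantSteps m (deg j / 2) := by
    rw [← neg_sub, neg_mem_circulantSteps]
  rw [card_filter_mem_circulantNeighbors hdeg he, card_filter_mem_circulantNeighbors hdeg he,
    add_assoc]
  simp only [symm]
  exact Nat.add_le_add_left (hg a c) _

theorem exists_outNeighbors {α ι : Type*} [DecidableEq α] (H : Finset α) (L : Finset ι)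
    (deg : ι → ℕ) (hdeg : ∀ j ∈ L, deg j ≤ H.card - 1) :
    ∃ T : ι → α → Finset α, (∀ j ∈ L, ∀ a ∈ H, T j a ⊆ H.erase a ∧ (T j a).card = deg j) ∧
      ∃ excess : Finset (α × α), excess.card ≤ 1 ∧ ∀ a ∈ H, ∀ c ∈ H,
        (L.filter fun j => c ∈ T j a).card ≤
          (L.filter fun j => a ∈ T j c).card + if (a, c) ∈ excess then 1 else 0 := by
  rcases H.eq_empty_or_nonempty with rfl | hH
  · exact ⟨fun _ _ => ∅, by simp, ∅, by simp, by simp⟩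
  have : NeZero H.card := ⟨hH.card_ne_zero⟩
  obtain ⟨φ, hφ⟩ := exists_bijOn_of_card_eq (A := H) (B := (univ : Finset (ZMod H.card)))
    (by rw [card_univ, ZMod.card])
  obtain ⟨T, hT, g, hg⟩ := exists_outNeighbors_zmod L deg fun j hj =>
    (hdeg j hj).trans_lt (Nat.pred_lt hH.card_ne_zero)
  refine ⟨fun j a => H.filter fun c => φ c ∈ T j (φ a), fun j hj a _ => ⟨fun c hc => ?_, ?_⟩,
    (H ×ˢ H).filter fun x => (φ x.1, φ x.2) = g, ?_, fun a ha c hc => ?_⟩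
  · obtain ⟨hc, hca⟩ := mem_filter.1 hc
    exact mem_erase.2 ⟨fun h => (hT j hj (φ a)).1 (h ▸ hca), hc⟩
  · rw [card_filter_mem_of_bijOn hφ (subset_univ _), (hT j hj (φ a)).2]
  · refine card_le_one.2 fun x hx y hy => ?_
    simp only [mem_filter, mem_product] at hx hy
    have hxy := Prod.mk.inj (hx.2.trans hy.2.symm)
    exact Prod.ext (hφ.injOn hx.1.1 hy.1.1 hxy.1) (hφ.injOn hx.1.2 hy.1.2 hxy.2)
  · simpa [ha, hc] using hg (φ a) (φ c)

end NearRegular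

variable {K N Nh Nr : ℕ}

section Levels

theorem mem_Kh {d : Fin K → Fin N} {u : Fin K} : u ∈ Kh Nh d ↔ IsHigh Nh (d u) := by simp [Kh]

theorem mem_Kl {d : Fin K → Fin N} {u : Fin K} : u ∈ Kl Nh Nr d ↔ IsLow Nh Nr (d u) := by
  simp [Kl]

theorem mem_Kr {d : Fin K → Fin N} {u : Fin K} : u ∈ Kr Nr d ↔ IsZero Nr (d u) := by simp [Kr]

theorem not_isZero_of_isHigh (hN : Nh + Nr ≤ N) {n : Fin N} (h : IsHigh Nh n) : ¬ IsZero Nr n := by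
  unfold IsHigh at h
  unfold IsZero
  omega

theorem disjoint_Kh_Kr (hN : Nh + Nr ≤ N) (d : Fin K → Fin N) : Disjoint (Kh Nh d) (Kr Nr d) :=
  disjoint_left.2 fun _ h h' => not_isZero_of_isHigh hN (mem_Kh.1 h) (mem_Kr.1 h')

theorem disjoint_Kh_Kl (d : Fin K → Fin N) : Disjoint (Kh Nh d) (Kl Nh Nr d) :=
  disjoint_left.2 fun _ h h' => (mem_Kl.1 h').1 (mem_Kh.1 h)

theorem disjoint_Kl_Kr (d : Fin K → Fin N) : Disjoint (Kl Nh Nr d) (Kr Nr d) :=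
  disjoint_left.2 fun _ h h' => (mem_Kl.1 h).2 (mem_Kr.1 h')

theorem mem_Kh_or_mem_Kl_or_mem_Kr (Nh Nr : ℕ) (d : Fin K → Fin N) (u : Fin K) :
    u ∈ Kh Nh d ∨ u ∈ Kl Nh Nr d ∨ u ∈ Kr Nr d := by
  rw [mem_Kh, mem_Kl, mem_Kr, IsLow]
  tauto

theorem card_Kh_add_card_Kl_add_card_Kr (hN : Nh + Nr ≤ N) (d : Fin K → Fin N) :
    (Kh Nh d).card + (Kl Nh Nr d).card + (Kr Nr d).card = K := by
  have cover : Kh Nh d ∪ Kl Nh Nr d ∪ Kr Nr d = univ := by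
    ext u
    simpa only [mem_union, mem_univ, iff_true, or_assoc] using mem_Kh_or_mem_Kl_or_mem_Kr Nh Nr d u
  rw [← card_union_of_disjoint (disjoint_Kh_Kl d), ← card_union_of_disjoint, cover, card_univ,
    Fintype.card_fin]
  exact disjoint_union_left.2 ⟨disjoint_Kh_Kr hN d, disjoint_Kl_Kr d⟩

theorem ne_of_mem_Kh_of_mem_Kl {d : Fin K → Fin N} {i j : Fin K} (hi : i ∈ Kh Nh d)
    (hj : j ∈ Kl Nh Nr d) : i ≠ j :=
  disjoint_iff_ne.1 (disjoint_Kh_Kl d) i hi j hj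

theorem card_isHigh (hN : Nh ≤ N) : (univ.filter fun n : Fin N => IsHigh Nh n).card = Nh :=
  (congrArg card (filter_congr fun _ _ => Iff.rfl)).trans
    (Fin.card_filter_val_lt.trans (min_eq_right hN))

theorem card_isZero (hN : Nr ≤ N) : (univ.filter fun n : Fin N => IsZero Nr n).card = Nr := by
  have zero_iff (n : Fin N) : IsZero Nr n ↔ ¬ IsHigh (N - Nr) n := by
    unfold IsZero IsHigh
    omega
  have split := card_filter_add_card_filter_not (s := univ) fun n : Fin N => IsHigh (N - Nr) n
  rw [card_isHigh (Nat.sub_le N Nr), card_univ, Fintype.card_fin] at split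
  simp only [zero_iff]
  omega

theorem card_isLow (hN : Nh + Nr ≤ N) :
    (univ.filter fun n : Fin N => IsLow Nh Nr n).card = N - (Nh + Nr) := by
  have compl : (univ.filter fun n : Fin N => IsLow Nh Nr n) =
      ((univ.filter fun n => IsHigh Nh n) ∪ univ.filter fun n => IsZero Nr n)ᶜ := by
    ext n
    rw [mem_filter_univ, IsLow]
    simp only [mem_compl, mem_union, mem_filter_univ, not_or]
  rw [compl, card_compl, Fintype.card_fin, card_union_of_disjoint
    (disjoint_filter.2 fun n _ => not_isZero_of_isHigh hN), card_isHigh (by omega),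
    card_isZero (by omega)]

end Levels

section Pairs

theorem card_pairs (K : ℕ) : Fintype.card (Pair K) = K.choose 2 := by
  rw [Fintype.card_finset_len, Fintype.card_fin]

theorem pair_eq_of_mem {s : Pair K} {a c : Fin K} (ha : a ∈ s.1) (hc : c ∈ s.1) (hac : a ≠ c) :
    s.1 = {a, c} :=
  (eq_of_subset_of_card_le (insert_subset ha (singleton_subset_iff.2 hc))
    (by rw [s.2, card_pair hac])).symm

theorem exists_pair_eq (s : Pair K) {a : Fin K} (ha : a ∈ s.1) : ∃ c, c ≠ a ∧ s.1 = {a, c} := by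
  obtain ⟨c, hc, hca⟩ := exists_mem_ne (by rw [s.2]; norm_num : 1 < s.1.card) a
  exact ⟨c, hca, pair_eq_of_mem ha hc hca.symm⟩

theorem pair_right_injective {α : Type*} [DecidableEq α] (j : α) :
    Function.Injective fun k => ({j, k} : Finset α) := by
  intro a c h
  have h : ({j, a} : Set α) = {j, c} := by simpa using congrArg (fun s : Finset α => (s : Set α)) h
  rcases Set.pair_eq_pair_iff.1 h with h | h
  · exact h.2
  · exact h.2.trans h.1

/-- The indices `{j, k}` with `k ∈ A`. For `j ∉ A` they correspond to the members of `A`; the sets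
`Ω_{i,j}` and `Z_{i,j}` are of this form. -/
def pairsWith (j : Fin K) (A : Finset (Fin K)) : Finset (Pair K) :=
  univ.filter fun s => ∃ k ∈ A, s.1 = {j, k}

theorem mem_pairsWith {j : Fin K} {A : Finset (Fin K)} {s : Pair K} :
    s ∈ pairsWith j A ↔ ∃ k ∈ A, s.1 = {j, k} := by
  simp [pairsWith]

theorem mem_of_mem_pairsWith {j : Fin K} {A : Finset (Fin K)} {s : Pair K}
    (hs : s ∈ pairsWith j A) : j ∈ s.1 := by
  obtain ⟨k, -, hk⟩ := mem_pairsWith.1 hs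
  exact hk ▸ mem_insert_self j _

theorem pairsWith_mono (j : Fin K) {A C : Finset (Fin K)} (h : A ⊆ C) :
    pairsWith j A ⊆ pairsWith j C := fun _ hs =>
  mem_pairsWith.2 ((mem_pairsWith.1 hs).imp fun _ hk => ⟨h hk.1, hk.2⟩)

theorem card_pairsWith {j : Fin K} {A : Finset (Fin K)} (hj : j ∉ A) :
    (pairsWith j A).card = A.card := by
  refine (card_bij (fun k hk => ⟨{j, k}, card_pair (ne_of_mem_of_not_mem hk hj).symm⟩)
    (fun k hk => mem_pairsWith.2 ⟨k, hk, rfl⟩)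
    (fun a _ c _ h => pair_right_injective j (congrArg Subtype.val h)) fun s hs => ?_).symm
  obtain ⟨k, hk, hs⟩ := mem_pairsWith.1 hs
  exact ⟨k, hk, Subtype.ext hs.symm⟩

theorem disjoint_pairsWith (j : Fin K) {A C : Finset (Fin K)} (h : Disjoint A C) :
    Disjoint (pairsWith j A) (pairsWith j C) := by
  refine disjoint_left.2 fun s hA hC => ?_
  obtain ⟨a, ha, hsa⟩ := mem_pairsWith.1 hA
  obtain ⟨c, hc, hsc⟩ := mem_pairsWith.1 hC
  rw [← pair_right_injective j (hsa.symm.trans hsc)] at hc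
  exact disjoint_left.1 h ha hc

theorem filter_mem_eq_pairsWith (u : Fin K) :
    (univ.filter fun s : Pair K => u ∈ s.1) = pairsWith u (univ.erase u) := by
  ext s
  refine ⟨fun h => ?_, fun h => mem_filter.2 ⟨mem_univ s, mem_of_mem_pairsWith h⟩⟩
  obtain ⟨c, hc, hs⟩ := exists_pair_eq s (mem_filter.1 h).2
  exact mem_pairsWith.2 ⟨c, mem_erase.2 ⟨hc, mem_univ c⟩, hs⟩

theorem card_filter_mem (u : Fin K) : (univ.filter fun s : Pair K => u ∈ s.1).card = K - 1 := by
  rw [filter_mem_eq_pairsWith, card_pairsWith (notMem_erase u univ), card_erase_of_mem (mem_univ u),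
    card_univ, Fintype.card_fin]

theorem setL_filter_eq_pairsWith {A : Finset (Fin K)} {i j : Fin K} (hj : j ∉ A) (hij : i ≠ j) :
    ((setL i j).filter fun s => ∃ k ∈ A, k ∈ s.1) = pairsWith j (A.erase i) := by
  ext s
  simp only [setL, mem_filter, mem_univ, true_and, mem_pairsWith, mem_erase]
  constructor
  · rintro ⟨⟨his, hjs⟩, k, hk, hks⟩
    exact ⟨k, ⟨ne_of_mem_of_not_mem hks his, hk⟩,
      pair_eq_of_mem hjs hks (ne_of_mem_of_not_mem hk hj).symm⟩
  · rintro ⟨k, ⟨hki, hk⟩, hs⟩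
    simp only [hs, mem_insert, mem_singleton]
    exact ⟨⟨by tauto, .inl trivial⟩, k, hk, .inr rfl⟩

end Pairs

section SubFileSets

variable {P : Placement K N Nh Nr} {d : Fin K → Fin N} {u i j : Fin K} {s : Pair K}

theorem mem_setL : s ∈ setL i j ↔ i ∉ s.1 ∧ j ∈ s.1 := by simp [setL]

theorem mem_setH : s ∈ setH P d i j ↔ P.owner (d j) s = i := by simp [setH]

theorem mem_setLambda : s ∈ setLambda Nh Nr d ↔ s.1 ⊆ Kl Nh Nr d := by simp [setLambda]

theorem setOmega_eq_pairsWith (hi : i ∈ Kh Nh d) (hj : j ∈ Kl Nh Nr d) :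
    setOmega Nh d i j = pairsWith j ((Kh Nh d).erase i) :=
  setL_filter_eq_pairsWith (disjoint_right.1 (disjoint_Kh_Kl d) hj) (ne_of_mem_Kh_of_mem_Kl hi hj)

theorem setZ_eq_pairsWith (hN : Nh + Nr ≤ N) (hi : i ∈ Kh Nh d) (hj : j ∈ Kl Nh Nr d) :
    setZ Nr d i j = pairsWith j (Kr Nr d) := by
  rw [setZ, setL_filter_eq_pairsWith (disjoint_left.1 (disjoint_Kl_Kr d) hj)
    (ne_of_mem_Kh_of_mem_Kl hi hj), erase_eq_of_notMem (disjoint_left.1 (disjoint_Kh_Kr hN d) hi)]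

theorem card_setH (hj : j ∈ Kl Nh Nr d) (i : Fin K) : (setH P d i j).card = (K - 1) / 2 :=
  P.balanced _ (mem_Kl.1 hj) i

theorem card_setOmega (hi : i ∈ Kh Nh d) (hj : j ∈ Kl Nh Nr d) :
    (setOmega Nh d i j).card = (Kh Nh d).card - 1 := by
  rw [setOmega_eq_pairsWith hi hj, card_pairsWith, card_erase_of_mem hi]
  exact fun h => disjoint_left.1 (disjoint_Kh_Kl d) (mem_of_mem_erase h) hj

theorem card_setZ (hN : Nh + Nr ≤ N) (hi : i ∈ Kh Nh d) (hj : j ∈ Kl Nh Nr d) :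
    (setZ Nr d i j).card = (Kr Nr d).card := by
  rw [setZ_eq_pairsWith hN hi hj, card_pairsWith (disjoint_left.1 (disjoint_Kl_Kr d) hj)]

theorem card_setLambda (Nh Nr : ℕ) (d : Fin K → Fin N) :
    (setLambda Nh Nr d).card = (Kl Nh Nr d).card.choose 2 := by
  rw [← card_powersetCard, ← card_map (Function.Embedding.subtype _)]
  congr 1
  ext s
  simp [mem_setLambda, mem_powersetCard, and_comm]

theorem setH_disjoint {i' : Fin K} (h : i ≠ i') : Disjoint (setH P d i j) (setH P d i' j) :=
  disjoint_left.2 fun _ hs hs' => h ((mem_setH.1 hs).symm.trans (mem_setH.1 hs'))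

theorem setOmega_disjoint {j' : Fin K} (hi : i ∈ Kh Nh d) (hj : j ∈ Kl Nh Nr d)
    (hj' : j' ∈ Kl Nh Nr d) (hjj' : j ≠ j') :
    Disjoint (setOmega Nh d i j) (setOmega Nh d i j') := by
  rw [setOmega_eq_pairsWith hi hj, setOmega_eq_pairsWith hi hj']
  refine disjoint_left.2 fun s hs hs' => ?_
  obtain ⟨k, hk, hsk⟩ := mem_pairsWith.1 hs
  have hj's : j' ∈ ({j, k} : Finset (Fin K)) := hsk ▸ mem_of_mem_pairsWith hs'
  rcases mem_insert.1 hj's with h | h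
  · exact hjj' h.symm
  · exact ne_of_mem_Kh_of_mem_Kl (mem_of_mem_erase hk) hj' (mem_singleton.1 h).symm

theorem setLambda_disjoint_pairsWith {A : Finset (Fin K)} (h : Disjoint (Kl Nh Nr d) A) :
    Disjoint (setLambda Nh Nr d) (pairsWith j A) := by
  refine disjoint_left.2 fun s hL hs => ?_
  obtain ⟨k, hk, hsk⟩ := mem_pairsWith.1 hs
  exact disjoint_left.1 h (mem_setLambda.1 hL (by simp [hsk])) hk

/-- The three constituents of `F_{i,j}` are disjoint. -/
theorem card_union_of_subset_setLambda_setZ_setOmega (hN : Nh + Nr ≤ N) (hi : i ∈ Kh Nh d)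
    (hj : j ∈ Kl Nh Nr d) {L Q O : Finset (Pair K)} (hL : L ⊆ setLambda Nh Nr d)
    (hQ : Q ⊆ setZ Nr d i j) (hO : O ⊆ setOmega Nh d i j) :
    (L ∪ Q ∪ O).card = L.card + Q.card + O.card := by
  rw [setZ_eq_pairsWith hN hi hj] at hQ
  rw [setOmega_eq_pairsWith hi hj] at hO
  have high_low : Disjoint ((Kh Nh d).erase i) (Kl Nh Nr d) :=
    (disjoint_Kh_Kl d).mono_left (erase_subset i _)
  have high_zero : Disjoint ((Kh Nh d).erase i) (Kr Nr d) :=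
    (disjoint_Kh_Kr hN d).mono_left (erase_subset i _)
  have LQ : Disjoint L Q := (setLambda_disjoint_pairsWith (disjoint_Kl_Kr d)).mono hL hQ
  have LO : Disjoint L O := (setLambda_disjoint_pairsWith high_low.symm).mono hL hO
  have QO : Disjoint Q O := (disjoint_pairsWith j high_zero.symm).mono hQ hO
  rw [card_union_of_disjoint (disjoint_union_left.2 ⟨LO, QO⟩), card_union_of_disjoint LQ]

theorem caches_of_mem_setH (hj : j ∈ Kl Nh Nr d) (hs : s ∈ setH P d u j) : P.Caches u (d j, s) :=
  .inr ⟨mem_Kl.1 hj, mem_setH.1 hs⟩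

theorem caches_of_mem (hi : i ∈ Kh Nh d) (hu : u ∈ s.1) : P.Caches u (d i, s) :=
  .inl ⟨mem_Kh.1 hi, hu⟩

end SubFileSets

section Placements

theorem nonempty_placement (hK : Odd K) : Nonempty (Placement K N Nh Nr) := by
  have hcard : Fintype.card (Pair K) = Fintype.card (Fin K × Fin ((K - 1) / 2)) := by
    rw [card_pairs, choose_two_of_odd hK, Fintype.card_prod, Fintype.card_fin, Fintype.card_fin]
  let e : Pair K ≃ Fin K × Fin ((K - 1) / 2) := Fintype.equivOfCardEq hcard
  refine ⟨⟨fun _ s => (e s).1, fun _ _ u => ?_⟩⟩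
  have fiber : (univ.filter fun s : Pair K => (e s).1 = u).map e.toEmbedding = {u} ×ˢ univ := by
    ext ⟨a, c⟩
    simp [mem_map_equiv, eq_comm]
  rw [← card_map e.toEmbedding, fiber, card_product, card_singleton, one_mul, card_univ,
    Fintype.card_fin]

namespace Placement

variable (P : Placement K N Nh Nr)

theorem card_caches_of_file (u : Fin K) (n : Fin N) :
    (univ.filter fun s : Pair K => P.Caches u (n, s)).card =
      (if IsHigh Nh n then K - 1 else 0) + if IsLow Nh Nr n then (K - 1) / 2 else 0 := by
  by_cases high : IsHigh Nh n
  · have not_low : ¬ IsLow Nh Nr n := fun h => h.1 high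
    simp only [Caches, high, not_low, true_and, false_and, or_false, if_true, if_false, add_zero,
      card_filter_mem]
  · by_cases low : IsLow Nh Nr n
    · simp only [Caches, high, low, true_and, false_and, false_or, if_true, if_false, zero_add,
        P.balanced n low u]
    · simp only [Caches, high, low, false_and, or_false, if_false, filter_false, card_empty,
        add_zero]

theorem card_cache (hN : Nh + Nr ≤ N) (u : Fin K) :
    (P.cache u).card = Nh * (K - 1) + (N - (Nh + Nr)) * ((K - 1) / 2) := by
  rw [cache, card_filter, Fintype.sum_prod_type]
  simp only [← card_filter, card_caches_of_file]
  rw [sum_add_distrib, ← sum_filter, ← sum_filter, sum_const, sum_const, card_isHigh (by omega),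
    card_isLow hN, smul_eq_mul, smul_eq_mul]

theorem cache_bits (hK : Odd K) (hN : Nh + Nr ≤ N) (b : ℕ) (u : Fin K) :
    (((P.cache u).card * b : ℕ) : ℚ) = cacheSize K N Nh Nr * (fileSize K b : ℚ) := by
  rw [P.card_cache hN, cacheSize, fileSize, choose_two_of_odd hK]
  obtain ⟨c, rfl⟩ := hK
  rw [Nat.add_sub_cancel, Nat.mul_div_cancel_left c two_pos]
  push_cast [Nat.cast_sub hN]
  have : 2 * (c : ℚ) + 1 ≠ 0 := by positivity
  field_simp
  ring

end Placement

end Placements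

namespace Delivery

variable {P : Placement K N Nh Nr} {d : Fin K → Fin N} (D : Delivery P d)

section Counting

variable {i j : Fin K}

theorem Lam_subset_setLambda (hi : i ∈ Kh Nh d) (hj : j ∈ Kl Nh Nr d) :
    D.Lam i j ⊆ setLambda Nh Nr d :=
  D.Lam_cover i hi ▸ subset_biUnion_of_mem (D.Lam i) hj

theorem equitableOn_card_Lam (hi : i ∈ Kh Nh d) :
    (Kl Nh Nr d : Set (Fin K)).EquitableOn fun j => (D.Lam i j).card :=
  fun j k hj hk => D.Lam_uniform i hi k hk j hj

theorem sum_card_Lam (hi : i ∈ Kh Nh d) :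
    ∑ j ∈ Kl Nh Nr d, (D.Lam i j).card = (Kl Nh Nr d).card.choose 2 := by
  rw [← card_setLambda, ← D.Lam_cover i hi,
    card_biUnion fun j hj k hk => D.Lam_disjoint i hi j hj k hk]

theorem card_Lam (hi : i ∈ Kh Nh d) (hj : j ∈ Kl Nh Nr d) :
    (D.Lam i j).card = ((Kl Nh Nr d).card - 1) / 2 ∨ (D.Lam i j).card = (Kl Nh Nr d).card / 2 :=
  eq_or_eq_of_sum_eq_choose_two (D.equitableOn_card_Lam hi) (D.sum_card_Lam hi) hj

theorem sum_comp_card_Lam (hi : i ∈ Kh Nh d) (g : ℕ → ℕ) :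
    ∑ j ∈ Kl Nh Nr d, g (D.Lam i j).card =
      ((Kl Nh Nr d).card - (Kl Nh Nr d).card / 2) * g (((Kl Nh Nr d).card - 1) / 2) +
        (Kl Nh Nr d).card / 2 * g ((Kl Nh Nr d).card / 2) :=
  sum_comp_of_sum_eq_choose_two (D.equitableOn_card_Lam hi) (D.sum_card_Lam hi) g

theorem sigma_eq (hN : Nh + Nr ≤ N) (hi : i ∈ Kh Nh d) (hj : j ∈ Kl Nh Nr d) :
    D.sigma i j = sigmaOf (D.Lam i j).card (Kr Nr d).card ((K - 1) / 2) := by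
  rw [sigma, card_setZ hN hi hj, card_setH hj]

theorem n_eq (hN : Nh + Nr ≤ N) (hi : i ∈ Kh Nh d) (hj : j ∈ Kl Nh Nr d) :
    D.n i j = nOf ((Kh Nh d).card - 1) (D.Lam i j).card (Kr Nr d).card ((K - 1) / 2) := by
  rw [n, card_setZ hN hi hj, card_setH hj, card_setOmega hi hj]

theorem card_Pi (hN : Nh + Nr ≤ N) (hi : i ∈ Kh Nh d) (hj : j ∈ Kl Nh Nr d) :
    (D.Pi i j).card =
      (Kr Nr d).card - sigmaOf (D.Lam i j).card (Kr Nr d).card ((K - 1) / 2) := by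
  have h := D.Pi_card i hi j hj
  have le := card_le_card (D.Pi_subset i hi j hj)
  rw [card_sdiff_of_subset (D.Pi_subset i hi j hj), card_setZ hN hi hj, card_setH hj] at h
  rw [card_setZ hN hi hj] at le
  omega

theorem card_setOmega_sdiff_Del (hN : Nh + Nr ≤ N) (hi : i ∈ Kh Nh d) (hj : j ∈ Kl Nh Nr d) :
    (setOmega Nh d i j \ D.Del i j).card = (Kh Nh d).card - 1 -
      nOf ((Kh Nh d).card - 1) (D.Lam i j).card (Kr Nr d).card ((K - 1) / 2) := by
  rw [card_sdiff_of_subset (D.Del_subset i hi j hj), D.Del_card i hi j hj, card_setOmega hi hj,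
    card_setZ hN hi hj, card_setH hj]

theorem card_F (hK : Odd K) (hN : Nh + Nr ≤ N) (hi : i ∈ Kh Nh d) (hj : j ∈ Kl Nh Nr d)
    (h : ¬ ((Kh Nh d).card = 1 ∧ (Kr Nr d).card = 0)) :
    (D.F i j).card = (setH P d i j).card := by
  rw [F, card_union_of_subset_setLambda_setZ_setOmega hN hi hj (D.Lam_subset_setLambda hi hj)
    (D.Pi_subset i hi j hj) sdiff_subset, D.card_Pi hN hi hj, D.card_setOmega_sdiff_Del hN hi hj,
    card_setH hj, sigmaOf, nOf]
  have levels := card_Kh_add_card_Kl_add_card_Kr hN d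
  have lam := D.card_Lam hi hj
  have high_pos := card_pos.2 ⟨i, hi⟩
  have low_pos := card_pos.2 ⟨j, hj⟩
  obtain ⟨c, hc⟩ := hK
  omega

theorem card_step1 (hN : Nh + Nr ≤ N) : D.step1.card =
    ((Kh Nh d).card + (Kr Nr d).card).choose 3 - (Kr Nr d).card.choose 3 := by
  have step1_eq : D.step1 = powersetCard 3 (Kh Nh d ∪ Kr Nr d) \ powersetCard 3 (Kr Nr d) := by
    ext S
    simp only [step1, mem_filter, mem_powersetCard, mem_sdiff]
    tauto
  rw [step1_eq, card_sdiff_of_subset (powersetCard_mono subset_union_right), card_powersetCard,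
    card_powersetCard, card_union_of_disjoint (disjoint_Kh_Kr hN d)]

theorem card_step2 : D.step2.card = (K - 1) / 2 * (Kl Nh Nr d).card.choose 2 := by
  rw [card_eq_sum_sum_of_mem_iff (A := Kl Nh Nr d) (B := fun j => (Kl Nh Nr d).filter (j < ·))
    (S := fun j k => setH P d k j) (by simp [step2, and_assoc]), ← card_product_filter_lt,
    card_eq_sum_of_mem_iff (A := Kl Nh Nr d) (S := fun j => (Kl Nh Nr d).filter (j < ·))
    (by simp [and_assoc]), mul_comm, sum_mul]
  exact sum_congr rfl fun j hj => sum_const_nat fun k _ => card_setH hj k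

theorem card_step3 :
    D.step3.card = (K - 1) / 2 * ((Kh Nh d).card * (Kl Nh Nr d).card) := by
  rw [card_eq_sum_sum_of_mem_iff (A := Kh Nh d) (B := fun _ => Kl Nh Nr d)
    (S := fun i j => setH P d i j) (by simp [step3]), mul_comm, mul_assoc]
  exact sum_const_nat fun i _ => sum_const_nat fun j hj => card_setH hj i

theorem mem_of_mem_B_parts {x : Fin K × Pair K} {p : Finset (Fin K × Pair K)}
    (hp : p ∈ D.B.parts) (hx : x ∈ p) :
    x.1 ∈ Kh Nh d ∧ ∃ j ∈ Kl Nh Nr d, x.2 ∈ D.Del x.1 j := by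
  simpa using D.B.le hp hx

theorem card_tagged_Del : (univ.filter fun x : Fin K × Pair K =>
      x.1 ∈ Kh Nh d ∧ ∃ j ∈ Kl Nh Nr d, x.2 ∈ D.Del x.1 j).card =
    ∑ i ∈ Kh Nh d, ∑ j ∈ Kl Nh Nr d, D.n i j := by
  rw [card_eq_sum_of_mem_iff (A := Kh Nh d) (S := fun i => (Kl Nh Nr d).biUnion (D.Del i))
    (by simp)]
  refine sum_congr rfl fun i hi => ?_
  rw [card_biUnion fun j hj k hk hjk => (setOmega_disjoint hi hj hk hjk).mono
    (D.Del_subset i hi j hj) (D.Del_subset i hi k hk)]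
  exact sum_congr rfl fun j hj => D.Del_card i hi j hj

theorem card_step4 : D.step4.card =
    ⌈((∑ i ∈ Kh Nh d, ∑ j ∈ Kl Nh Nr d, D.n i j : ℕ) : ℚ) / 2⌉₊ := by
  rw [step4, card_parts_eq_ceil_half D.B (fun p hp => ?_) D.B_single, card_tagged_Del]
  refine (D.B_parts p hp).imp_right ?_
  rintro ⟨i, k, s, t, hik, -, -, rfl⟩
  exact card_pair fun h => hik (congrArg Prod.fst h)

theorem card_step5low :
    D.step5low.card = (Kl Nh Nr d).card * (Kr Nr d).card * ((K - 1) / 2) := by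
  rw [card_eq_sum_of_mem_iff (A := Kl Nh Nr d)
    (S := fun j => (Kr Nr d).biUnion fun r => setH P d r j) (by simp [step5low, mem_setH]),
    mul_assoc]
  refine sum_const_nat fun j hj => ?_
  rw [card_biUnion fun r _ r' _ => setH_disjoint]
  exact sum_const_nat fun r _ => card_setH hj r

theorem card_step5high :
    D.step5high.card = ∑ i ∈ Kh Nh d, ∑ j ∈ Kl Nh Nr d, D.sigma i j := by
  rw [card_eq_sum_sum_of_mem_iff (A := Kh Nh d) (B := fun _ => Kl Nh Nr d)
    (S := fun i j => setZ Nr d i j \ D.Pi i j) (by simp [step5high])]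
  exact sum_congr rfl fun i hi => sum_congr rfl fun j hj => D.Pi_card i hi j hj

theorem card_step5zero : D.step5zero.card = (Kr Nr d).card * K.choose 2 := by
  rw [card_eq_sum_of_mem_iff (A := Kr Nr d) (S := fun _ => univ) (by simp [step5zero])]
  exact sum_const_nat fun _ _ => card_pairs K

theorem sum_sigma (hN : Nh + Nr ≤ N) : ∑ i ∈ Kh Nh d, ∑ j ∈ Kl Nh Nr d, D.sigma i j =
    sigmaSum K (Kh Nh d).card (Kl Nh Nr d).card (Kr Nr d).card :=
  sum_const_nat fun _ hi => (sum_congr rfl fun _ hj => D.sigma_eq hN hi hj).trans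
    (D.sum_comp_card_Lam hi fun x => sigmaOf x (Kr Nr d).card ((K - 1) / 2))

theorem sum_n (hN : Nh + Nr ≤ N) : ∑ i ∈ Kh Nh d, ∑ j ∈ Kl Nh Nr d, D.n i j =
    nSum K (Kh Nh d).card (Kl Nh Nr d).card (Kr Nr d).card :=
  sum_const_nat fun _ hi => (sum_congr rfl fun _ hj => D.n_eq hN hi hj).trans
    (D.sum_comp_card_Lam hi fun x => nOf ((Kh Nh d).card - 1) x (Kr Nr d).card ((K - 1) / 2))

theorem card_steps (hN : Nh + Nr ≤ N) :
    D.step1.card + D.step2.card + D.step3.card + D.step4.card +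
      (D.step5low.card + D.step5high.card) =
      NT K (Kh Nh d).card (Kl Nh Nr d).card (Kr Nr d).card := by
  rw [D.card_step1 hN, D.card_step2, D.card_step3, D.card_step4, D.card_step5low, D.card_step5high,
    D.sum_sigma hN, D.sum_n hN, NT]

theorem card_index (hN : Nh + Nr ≤ N) : Fintype.card D.Index =
    NT K (Kh Nh d).card (Kl Nh Nr d).card (Kr Nr d).card + (Kr Nr d).card * K.choose 2 := by
  rw [← D.card_steps hN, ← D.card_step5zero]
  simp only [Index, Fintype.card_sum, Fintype.card_coe]
  ring

theorem rate_eq (hK : 2 ≤ K) (hN : Nh + Nr ≤ N) {b : ℕ} (hb : 0 < b) :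
    D.rate b = (NT K (Kh Nh d).card (Kl Nh Nr d).card (Kr Nr d).card : ℚ) / (K.choose 2 : ℚ) +
      ((Kr Nr d).card : ℚ) := by
  have bits_ne_zero : (b : ℚ) ≠ 0 := by exact_mod_cast hb.ne'
  have pairs_ne_zero : (K.choose 2 : ℚ) ≠ 0 := by exact_mod_cast (Nat.choose_pos hK).ne'
  rw [rate, fileSize, D.card_index hN]
  push_cast
  field_simp

end Counting

section Decoding

variable {u i j : Fin K} {b : ℕ} {s : Pair K}

/-- The content of the sub-file `x` is determined by the messages and by the cache of `u`. All of
these depend linearly on the library, so this is stated as a kernel condition: `x` vanishes in every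
library in which the messages and the cache of `u` vanish. -/
def Determined (b : ℕ) (u : Fin K) (x : SubFile K N) : Prop :=
  ∀ V : Library K N b, (∀ m, D.transmit V m = 0) → (∀ y, P.Caches u y → V y.1 y.2 = 0) →
    V x.1 x.2 = 0

theorem transmit_sub (W W' : Library K N b) :
    D.transmit (W - W') = D.transmit W - D.transmit W' :=
  funext fun _ => sum_sub_distrib _ _

theorem decodable_of_determined (h : ∀ u s, D.Determined b u (d u, s)) : D.Decodable b := by
  classical
  intro u
  let observe (W : Library K N b) : (D.Index → Bits b) × (P.cache u → Bits b) :=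
    (D.transmit W, fun x => W x.1.1 x.1.2)
  have factors : Function.FactorsThrough (fun W : Library K N b => W (d u)) observe := by
    intro W W' hW
    obtain ⟨same_messages, same_cache⟩ := Prod.mk.inj hW
    refine funext fun s => sub_eq_zero.1 (h u s (W - W') (fun m => ?_) fun y hy => ?_)
    · rw [transmit_sub, same_messages, sub_self, Pi.zero_apply]
    · exact sub_eq_zero.2 (congrFun same_cache ⟨y, mem_filter.2 ⟨mem_univ y, hy⟩⟩)
  exact ⟨fun m c => Function.extend observe (fun W => W (d u)) (fun _ => 0) (m, c),
    factors.extend_apply _⟩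

variable {D}

theorem Determined.of_caches {x : SubFile K N} (h : P.Caches u x) : D.Determined b u x :=
  fun _ _ hV => hV x h

theorem Determined.of_msg {x : SubFile K N} (m : D.Index) (hx : x ∈ D.msg m)
    (others : ∀ y ∈ D.msg m, y ≠ x → P.Caches u y) : D.Determined b u x := by
  intro V hm hV
  rw [← sum_eq_single_of_mem x hx fun y hy hyx => hV y (others y hy hyx)]
  exact hm m

theorem Determined.of_unicast {x : SubFile K N} (m : D.Index) (hm : D.msg m = {x}) :
    D.Determined b u x :=
  of_msg m (hm ▸ mem_singleton_self x) fun _ hy hyx => absurd (mem_singleton.1 (hm ▸ hy)) hyx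

variable (D)

theorem F_subset_setL (hi : i ∈ Kh Nh d) (hj : j ∈ Kl Nh Nr d) : D.F i j ⊆ setL i j :=
  union_subset (union_subset (D.Lam_subset i hi j hj)
    ((D.Pi_subset i hi j hj).trans (filter_subset _ _))) (sdiff_subset.trans (filter_subset _ _))

theorem determined_zero (hu : u ∈ Kr Nr d) (s : Pair K) : D.Determined b u (d u, s) :=
  .of_unicast (.inr (.inr (.inr (.inr (.inr (.inr ⟨(u, s), by simpa [step5zero] using hu⟩)))))) rfl

theorem determined_low_of_owner_mem_Kh (hu : u ∈ Kl Nh Nr d) (ho : P.owner (d u) s ∈ Kh Nh d) :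
    D.Determined b u (d u, s) := by
  refine .of_msg (.inr (.inr (.inl ⟨(P.owner (d u) s, u, s), by simp [step3, ho, hu, mem_setH]⟩)))
    (mem_insert_self _ _) fun y hy hyx => ?_
  rcases mem_insert.1 hy with rfl | hy
  · exact absurd rfl hyx
  · obtain ⟨t, ht, rfl⟩ := mem_image.1 hy
    exact caches_of_mem ho (mem_setL.1 (D.F_subset_setL ho hu (mem_filter.1 ht).1)).2

theorem determined_low_of_owner_mem_Kl {k : Fin K} (hu : u ∈ Kl Nh Nr d) (hk : k ∈ Kl Nh Nr d)
    (hs : s ∈ setH P d k u) : D.Determined b u (d u, s) := by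
  rcases lt_trichotomy u k with h | rfl | h
  · refine .of_msg (.inr (.inl ⟨(u, k, s), by simp [step2, hk, hu, h, hs]⟩))
      (mem_insert_self _ _) fun y hy hyx => ?_
    rcases mem_insert.1 hy with rfl | hy
    · exact absurd rfl hyx
    · exact mem_singleton.1 hy ▸ caches_of_mem_setH hk ((D.lowPair_bij u hu k hk h).mapsTo hs)
  · exact .of_caches (caches_of_mem_setH hu hs)
  · obtain ⟨t, ht, rfl⟩ := (D.lowPair_bij k hk u hu h).surjOn hs
    refine .of_msg (.inr (.inl ⟨(k, u, t), by simpa [step2, hk, hu, h] using ht⟩))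
      (mem_insert_of_mem (mem_singleton_self _)) fun y hy hyx => ?_
    rcases mem_insert.1 hy with rfl | hy
    · exact caches_of_mem_setH hk ht
    · exact absurd (mem_singleton.1 hy) hyx

theorem determined_low (hu : u ∈ Kl Nh Nr d) (s : Pair K) : D.Determined b u (d u, s) := by
  rcases mem_Kh_or_mem_Kl_or_mem_Kr Nh Nr d (P.owner (d u) s) with ho | ho | ho
  · exact D.determined_low_of_owner_mem_Kh hu ho
  · exact D.determined_low_of_owner_mem_Kl hu ho (mem_setH.2 rfl)
  · exact .of_unicast (.inr (.inr (.inr (.inr (.inl ⟨(u, s), by simp [step5low, hu, ho]⟩))))) rfl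

theorem determined_of_mem_F (hu : u ∈ Kh Nh d) (hj : j ∈ Kl Nh Nr d) (hs : s ∈ D.F u j) :
    D.Determined b u (d u, s) := by
  have partner_mem := D.cross_maps u hu j hj s hs
  refine .of_msg (.inr (.inr (.inl ⟨(u, j, D.cross u j s), by simp [step3, hu, hj, partner_mem]⟩)))
    (mem_insert_of_mem (mem_image.2 ⟨s, mem_filter.2 ⟨hs, rfl⟩, rfl⟩)) fun y hy hyx => ?_
  rcases mem_insert.1 hy with rfl | hy
  · exact caches_of_mem_setH hj partner_mem
  · obtain ⟨t, ht, rfl⟩ := mem_image.1 hy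
    obtain ⟨ht, same_partner⟩ := mem_filter.1 ht
    exact absurd (congrArg (Prod.mk (d u)) (D.cross_inj u hu j hj ht hs same_partner)) hyx

theorem determined_of_mem_Del (hu : u ∈ Kh Nh d) (hj : j ∈ Kl Nh Nr d) (hs : s ∈ D.Del u j) :
    D.Determined b u (d u, s) := by
  obtain ⟨p, hp, hx⟩ := D.B.exists_mem (a := (u, s)) (by simpa [hu] using ⟨j, hj, hs⟩)
  refine .of_msg (.inr (.inr (.inr (.inl ⟨p, hp⟩)))) (mem_image.2 ⟨(u, s), hx, rfl⟩)
    fun y hy hyx => ?_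
  obtain ⟨z, hz, rfl⟩ := mem_image.1 hy
  refine caches_of_mem (D.mem_of_mem_B_parts hp hz).1 ?_
  rcases D.B_parts p hp with single | ⟨i, k, t, t', hik, hi, hk, rfl⟩
  · exact absurd (by rw [card_le_one.1 single.le z hz _ hx]) hyx
  · simp only [mem_insert, mem_singleton, Prod.mk.injEq] at hx hz
    rcases hx with ⟨rfl, rfl⟩ | ⟨rfl, rfl⟩ <;> rcases hz with rfl | rfl
    · exact absurd rfl hyx
    · exact hi
    · exact hk
    · exact absurd rfl hyx

theorem determined_of_subset_union (hN : Nh + Nr ≤ N) (hu : u ∈ Kh Nh d) (hus : u ∉ s.1)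
    (hs : s.1 ⊆ Kh Nh d ∪ Kr Nr d) : D.Determined b u (d u, s) := by
  have mem_step1 : insert u s.1 ∈ D.step1 := by
    rw [step1, mem_filter, mem_powersetCard, card_insert_of_notMem hus, s.2]
    exact ⟨⟨insert_subset (mem_union_left _ hu) hs, rfl⟩,
      fun h => disjoint_left.1 (disjoint_Kh_Kr hN d) hu (h (mem_insert_self _ _))⟩
  refine .of_msg (.inl ⟨insert u s.1, mem_step1⟩) ?_ ?_ <;>
    simp only [msg, msg1, mem_filter, mem_univ, true_and]
  · exact ⟨u, mem_insert_self _ _, hu, rfl, (erase_insert hus).symm⟩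
  · rintro ⟨_, t⟩ ⟨v, -, hv, rfl, ht⟩ hyx
    refine caches_of_mem hv (ht ▸ mem_erase.2 ⟨?_, mem_insert_self _ _⟩)
    rintro rfl
    exact hyx (congrArg (Prod.mk (d u)) (Subtype.ext (ht.trans (erase_insert hus))))

theorem determined_high (hN : Nh + Nr ≤ N) (hu : u ∈ Kh Nh d) (s : Pair K) :
    D.Determined b u (d u, s) := by
  by_cases hus : u ∈ s.1
  · exact .of_caches (caches_of_mem hu hus)
  by_cases hsub : s.1 ⊆ Kh Nh d ∪ Kr Nr d
  · exact D.determined_of_subset_union hN hu hus hsub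
  obtain ⟨j, hjs, hj⟩ := not_subset.1 hsub
  replace hj : j ∈ Kl Nh Nr d := by
    have := mem_Kh_or_mem_Kl_or_mem_Kr Nh Nr d j
    rw [mem_union] at hj
    tauto
  obtain ⟨k, -, hs⟩ := exists_pair_eq s hjs
  have hks : k ∈ s.1 := by simp [hs]
  have hL : s ∈ setL u j := mem_setL.2 ⟨hus, hjs⟩
  rcases mem_Kh_or_mem_Kl_or_mem_Kr Nh Nr d k with hk | hk | hk
  · have hOmega : s ∈ setOmega Nh d u j := mem_filter.2 ⟨hL, k, hk, hks⟩
    by_cases hDel : s ∈ D.Del u j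
    · exact D.determined_of_mem_Del hu hj hDel
    · exact D.determined_of_mem_F hu hj (mem_union_right _ (mem_sdiff.2 ⟨hOmega, hDel⟩))
  · have hLambda : s ∈ setLambda Nh Nr d :=
      mem_setLambda.2 (hs ▸ insert_subset hj (singleton_subset_iff.2 hk))
    rw [← D.Lam_cover u hu] at hLambda
    obtain ⟨l, hl, hsl⟩ := mem_biUnion.1 hLambda
    exact D.determined_of_mem_F hu hl (mem_union_left _ (mem_union_left _ hsl))
  · have hZ : s ∈ setZ Nr d u j := mem_filter.2 ⟨hL, k, hk, hks⟩
    by_cases hPi : s ∈ D.Pi u j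
    · exact D.determined_of_mem_F hu hj (mem_union_left _ (mem_union_right _ hPi))
    · exact .of_unicast (.inr (.inr (.inr (.inr (.inr (.inl
        ⟨(u, j, s), by simp [step5high, hu, hj, hZ, hPi]⟩)))))) rfl

theorem decodable (hN : Nh + Nr ≤ N) (b : ℕ) : D.Decodable b :=
  D.decodable_of_determined fun u s => by
    rcases mem_Kh_or_mem_Kl_or_mem_Kr Nh Nr d u with hu | hu | hu
    · exact D.determined_high hN hu s
    · exact D.determined_low hu s
    · exact D.determined_zero hu s

end Decoding

end Delivery

section Choices

theorem exists_equitable_partition_pairs (A : Finset (Fin K)) :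
    ∃ L : Fin K → Finset (Pair K), (∀ j ∈ A, ∀ s ∈ L j, j ∈ s.1) ∧
      A.biUnion L = univ.filter (fun s : Pair K => s.1 ⊆ A) ∧
      (A : Set (Fin K)).PairwiseDisjoint L ∧
      (A : Set (Fin K)).EquitableOn fun j => (L j).card := by
  obtain ⟨T, hT, hTsymm, hTeq⟩ := exists_equitable_tournament A
  have card_eq : ∀ j ∈ A, (pairsWith j (T j)).card = (T j).card := fun j hj =>
    card_pairsWith fun h => notMem_erase j A (hT j hj h)
  refine ⟨fun j => pairsWith j (T j), fun j _ s => mem_of_mem_pairsWith, ?_, ?_, ?_⟩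
  · ext s
    rw [mem_biUnion, mem_filter_univ]
    constructor
    · rintro ⟨j, hj, hs⟩
      obtain ⟨k, hk, hs⟩ := mem_pairsWith.1 hs
      rw [hs]
      exact insert_subset hj (singleton_subset_iff.2 (mem_of_mem_erase (hT j hj hk)))
    · obtain ⟨a, c, hac, hs⟩ := card_eq_two.1 s.2
      intro hsA
      rw [hs, insert_subset_iff, singleton_subset_iff] at hsA
      by_cases hc : c ∈ T a
      · exact ⟨a, hsA.1, mem_pairsWith.2 ⟨c, hc, hs⟩⟩
      · have ha : a ∈ T c := (hTsymm c hsA.2 a hsA.1 hac.symm).2 hc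
        exact ⟨c, hsA.2, mem_pairsWith.2 ⟨a, ha, hs.trans (pair_comm a c)⟩⟩
  · refine fun j hj j' hj' hjj' => disjoint_left.2 fun s hs hs' => ?_
    have hjs : j ∈ s.1 := mem_of_mem_pairsWith hs
    have hj's : j' ∈ s.1 := mem_of_mem_pairsWith hs'
    have hs_eq : s.1 = {j, j'} := pair_eq_of_mem hjs hj's hjj'
    obtain ⟨k, hk, hsk⟩ := mem_pairsWith.1 hs
    obtain ⟨k', hk', hsk'⟩ := mem_pairsWith.1 hs'
    obtain rfl := pair_right_injective j (hs_eq.symm.trans hsk)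
    obtain rfl := pair_right_injective j' ((pair_comm j' j).trans (hs_eq.symm.trans hsk'))
    exact (hTsymm j hj j' hj' hjj').1 hk hk'
  · intro a c ha hc
    simpa only [card_eq a ha, card_eq c hc] using hTeq ha hc

theorem eq_of_pair_eq_of_disjoint {α : Type*} [DecidableEq α] {H L : Finset α}
    (hHL : Disjoint H L) {j j' k k' : α} (hj' : j' ∈ L) (hk : k ∈ H)
    (h : ({j, k} : Finset α) = {j', k'}) : k = k' := by
  have hk' : k ∈ ({j', k'} : Finset α) := h ▸ mem_insert_of_mem (mem_singleton_self k)
  rcases mem_insert.1 hk' with rfl | hk'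
  · exact absurd hj' (disjoint_left.1 hHL hk)
  · exact mem_singleton.1 hk'

theorem exists_high_end {H L : Finset (Fin K)} (hHL : Disjoint H L) :
    ∃ e : Pair K → Fin K, ∀ s, ∀ j ∈ L, ∀ k ∈ H, s.1 = {j, k} → e s = k := by
  suffices h : ∀ s : Pair K, ∃ e, ∀ j ∈ L, ∀ k ∈ H, s.1 = {j, k} → e = k by
    choose e he using h
    exact ⟨e, he⟩
  intro s
  by_cases h : ∃ j ∈ L, ∃ k ∈ H, s.1 = {j, k}
  · obtain ⟨j, -, k, hk, hs⟩ := h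
    exact ⟨k, fun j' hj' k' _ hs' => eq_of_pair_eq_of_disjoint hHL hj' hk (hs.symm.trans hs')⟩
  · obtain ⟨a, -⟩ := card_pos.1 (by rw [s.2]; norm_num : 0 < s.1.card)
    exact ⟨a, fun j hj k hk hs => absurd ⟨j, hj, k, hk, hs⟩ h⟩

/-- The sub-files `(i, {j, k})` with `i ∈ H`, `j ∈ L` and `k ∈ T j i`, tagged by the requesting
user `i`; such a sub-file is regarded as an arc from `i` to `k`. Two arcs with opposite ends are
sub-files whose XOR serves both requesting users. -/
def arcs (H L : Finset (Fin K)) (T : Fin K → Fin K → Finset (Fin K)) :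
    Finset (Fin K × Pair K) :=
  univ.filter fun x => x.1 ∈ H ∧ ∃ j ∈ L, x.2 ∈ pairsWith j (T j x.1)

section Arcs

variable {H L : Finset (Fin K)} {T : Fin K → Fin K → Finset (Fin K)}

theorem mem_arcs (hT : ∀ j ∈ L, ∀ i ∈ H, T j i ⊆ H.erase i) {e : Pair K → Fin K}
    (he : ∀ s, ∀ j ∈ L, ∀ k ∈ H, s.1 = {j, k} → e s = k) {x : Fin K × Pair K} :
    x ∈ arcs H L T ↔ x.1 ∈ H ∧ ∃ j ∈ L, e x.2 ∈ T j x.1 ∧ x.2.1 = {j, e x.2} := by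
  rw [arcs, mem_filter_univ]
  refine and_congr_right fun hi => exists_congr fun j => and_congr_right fun hj => ?_
  rw [mem_pairsWith]
  refine ⟨?_, fun h => ⟨_, h⟩⟩
  rintro ⟨k, hk, hs⟩
  obtain rfl := he x.2 j hj k (mem_of_mem_erase (hT j hj _ hi hk)) hs
  exact ⟨hk, hs⟩

theorem card_filter_arcs (hHL : Disjoint H L) (hT : ∀ j ∈ L, ∀ i ∈ H, T j i ⊆ H.erase i)
    {e : Pair K → Fin K} (he : ∀ s, ∀ j ∈ L, ∀ k ∈ H, s.1 = {j, k} → e s = k) {i k : Fin K}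
    (hi : i ∈ H) (hk : k ∈ H) :
    ((arcs H L T).filter fun x => (x.1, e x.2) = (i, k)).card =
      (L.filter fun j => k ∈ T j i).card := by
  have hjk {j : Fin K} (hj : j ∈ L) : j ≠ k := (disjoint_iff_ne.1 hHL k hk j hj).symm
  refine (card_bij (fun j hj => (i, ⟨{j, k}, card_pair (hjk (mem_filter.1 hj).1)⟩)) ?_ ?_ ?_).symm
  · intro j hj
    obtain ⟨hj, hkT⟩ := mem_filter.1 hj
    have end_eq : e ⟨{j, k}, card_pair (hjk hj)⟩ = k := he _ j hj k hk rfl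
    rw [mem_filter, mem_arcs hT he, end_eq]
    exact ⟨⟨hi, j, hj, hkT, rfl⟩, rfl⟩
  · intro j _ j' _ h
    have h := congrArg (fun x : Fin K × Pair K => x.2.1) h
    exact pair_right_injective k ((pair_comm k j).trans (h.trans (pair_comm j' k)))
  · rintro ⟨i', s⟩ hx
    obtain ⟨hmem, h⟩ := mem_filter.1 hx
    obtain ⟨rfl, rfl⟩ := Prod.mk.inj h
    obtain ⟨-, j, hj, hkT, hs⟩ := (mem_arcs hT he).1 hmem
    exact ⟨j, mem_filter.2 ⟨hj, hkT⟩, Prod.ext rfl (Subtype.ext hs.symm)⟩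

theorem exists_finpartition_arcs (hHL : Disjoint H L)
    (hT : ∀ j ∈ L, ∀ i ∈ H, T j i ⊆ H.erase i) {excess : Finset (Fin K × Fin K)}
    (hexcess : ∀ a ∈ H, ∀ c ∈ H, (L.filter fun j => c ∈ T j a).card ≤
      (L.filter fun j => a ∈ T j c).card + if (a, c) ∈ excess then 1 else 0) :
    ∃ B : Finpartition (arcs H L T),
      (∀ p ∈ B.parts, p.card = 1 ∨ ∃ i k : Fin K, ∃ s t : Pair K,
        i ≠ k ∧ i ∈ t.1 ∧ k ∈ s.1 ∧ p = {(i, s), (k, t)}) ∧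
      (B.parts.filter fun p => p.card = 1).card ≤ excess.card := by
  obtain ⟨e, he⟩ := exists_high_end hHL
  have ends {x : Fin K × Pair K} (hx : x ∈ arcs H L T) :
      x.1 ∈ H ∧ e x.2 ∈ H ∧ e x.2 ≠ x.1 ∧ e x.2 ∈ x.2.1 := by
    obtain ⟨hi, j, hj, hk, hs⟩ := (mem_arcs hT he).1 hx
    obtain ⟨hki, hkH⟩ := mem_erase.1 (hT j hj _ hi hk)
    exact ⟨hi, hkH, hki, hs.symm ▸ mem_insert_of_mem (mem_singleton_self _)⟩
  have balanced (g : Fin K × Fin K) : ((arcs H L T).filter fun x => (x.1, e x.2) = g).card ≤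
      ((arcs H L T).filter fun x => (x.1, e x.2) = g.swap).card +
        if g ∈ excess then 1 else 0 := by
    obtain ⟨i, k⟩ := g
    by_cases hik : i ∈ H ∧ k ∈ H
    · exact (card_filter_arcs hHL hT he hik.1 hik.2).trans_le
        ((hexcess i hik.1 k hik.2).trans_eq
          (congrArg (· + _) (card_filter_arcs hHL hT he hik.2 hik.1).symm))
    · rw [filter_false_of_mem]
      · exact Nat.zero_le _
      · rintro x hx h
        obtain ⟨rfl, rfl⟩ := Prod.mk.inj h
        exact hik ⟨(ends hx).1, (ends hx).2.1⟩
  obtain ⟨B, hB, hsingle⟩ := exists_finpartition_pairs Prod.swap_swap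
    (fun x : Fin K × Pair K => (x.1, e x.2)) (arcs H L T)
    (fun x hx h => (ends hx).2.2.1 (Prod.mk.inj h).1) excess balanced
  refine ⟨B, fun p hp => (hB p hp).imp_right ?_, hsingle⟩
  rintro ⟨x, hx, y, hy, hxy, rfl⟩
  obtain ⟨hy1, hy2⟩ := Prod.mk.inj hxy
  obtain ⟨-, -, hne, hmem⟩ := ends hx
  exact ⟨x.1, y.1, x.2, y.2, hy1 ▸ hne.symm, hy2 ▸ (ends hy).2.2.2, hy1 ▸ hmem, rfl⟩

end Arcs

theorem exists_exchangeable_subsets {H L : Finset (Fin K)} (hHL : Disjoint H L) (deg : Fin K → ℕ)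
    (hdeg : ∀ j ∈ L, deg j ≤ H.card - 1) :
    ∃ Del : Fin K → Fin K → Finset (Pair K),
      (∀ i ∈ H, ∀ j ∈ L, Del i j ⊆ pairsWith j (H.erase i) ∧ (Del i j).card = deg j) ∧
      ∃ B : Finpartition (univ.filter fun x : Fin K × Pair K =>
          x.1 ∈ H ∧ ∃ j ∈ L, x.2 ∈ Del x.1 j),
        (∀ p ∈ B.parts, p.card = 1 ∨ ∃ i k : Fin K, ∃ s t : Pair K,
          i ≠ k ∧ i ∈ t.1 ∧ k ∈ s.1 ∧ p = {(i, s), (k, t)}) ∧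
        (B.parts.filter fun p => p.card = 1).card ≤ 1 := by
  obtain ⟨T, hT, excess, hcard, hexcess⟩ := exists_outNeighbors H L deg hdeg
  obtain ⟨B, hB, hsingle⟩ :=
    exists_finpartition_arcs hHL (fun j hj i hi => (hT j hj i hi).1) hexcess
  refine ⟨fun i j => pairsWith j (T j i), fun i hi j hj => ?_, B, hB, hsingle.trans hcard⟩
  obtain ⟨hsub, hdeg⟩ := hT j hj i hi
  have hj : j ∉ T j i := fun h => disjoint_left.1 hHL (mem_of_mem_erase (hsub h)) hj
  exact ⟨pairsWith_mono j hsub, (card_pairsWith hj).trans hdeg⟩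

theorem exists_subset_card_sdiff_eq {α : Type*} [DecidableEq α] {s : Finset α} {m : ℕ}
    (h : m ≤ s.card) : ∃ t ⊆ s, (s \ t).card = m := by
  obtain ⟨u, hu, rfl⟩ := exists_subset_card_eq h
  exact ⟨s \ u, sdiff_subset, congrArg card (Finset.sdiff_sdiff_eq_self hu)⟩

variable {P : Placement K N Nh Nr} {d : Fin K → Fin N} {i j : Fin K}

theorem exists_lowPair [Nonempty (Pair K)] (hj : j ∈ Kl Nh Nr d) (hi : i ∈ Kl Nh Nr d) :
    ∃ φ : Pair K → Pair K, Set.BijOn φ (setH P d i j) (setH P d j i) :=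
  exists_bijOn_of_card_eq ((card_setH hj i).trans (card_setH hi j).symm)

theorem exists_Lam (Nh Nr : ℕ) (d : Fin K → Fin N) :
    ∃ L : Fin K → Finset (Pair K), (∀ i ∈ Kh Nh d, ∀ j ∈ Kl Nh Nr d, L j ⊆ setL i j) ∧
      (Kl Nh Nr d).biUnion L = setLambda Nh Nr d ∧
      (Kl Nh Nr d : Set (Fin K)).PairwiseDisjoint L ∧
      (Kl Nh Nr d : Set (Fin K)).EquitableOn fun j => (L j).card := by
  obtain ⟨L, hL, cover, disjoint, equitable⟩ := exists_equitable_partition_pairs (Kl Nh Nr d)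
  refine ⟨L, fun i hi j hj s hs => mem_setL.2 ⟨fun his => ?_, hL j hj s hs⟩, cover, disjoint,
    equitable⟩
  have low : s.1 ⊆ Kl Nh Nr d := mem_setLambda.1 (cover.subset (mem_biUnion.2 ⟨j, hj, hs⟩))
  exact disjoint_left.1 (disjoint_Kh_Kl d) hi (low his)

theorem card_le_card_setH (hN : Nh + Nr ≤ N) {L : Fin K → Finset (Pair K)}
    (cover : (Kl Nh Nr d).biUnion L = setLambda Nh Nr d)
    (disjoint : (Kl Nh Nr d : Set (Fin K)).PairwiseDisjoint L)
    (equitable : (Kl Nh Nr d : Set (Fin K)).EquitableOn fun j => (L j).card)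
    (hi : i ∈ Kh Nh d) (hj : j ∈ Kl Nh Nr d) : (L j).card ≤ (setH P d i j).card := by
  have sum_card : ∑ j ∈ Kl Nh Nr d, (L j).card = (Kl Nh Nr d).card.choose 2 := by
    rw [← card_setLambda, ← cover, card_biUnion disjoint]
  have card_L := eq_or_eq_of_sum_eq_choose_two equitable sum_card hj
  have levels := card_Kh_add_card_Kl_add_card_Kr hN d
  have high_pos := card_pos.2 ⟨i, hi⟩
  rw [card_setH hj]
  omega

theorem exists_Pi {L : Finset (Pair K)} (hL : L.card ≤ (setH P d i j).card) :
    ∃ Q ⊆ setZ Nr d i j, (setZ Nr d i j \ Q).card =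
      sigmaOf L.card (setZ Nr d i j).card (setH P d i j).card := by
  refine exists_subset_card_sdiff_eq ?_
  unfold sigmaOf
  omega

theorem exists_Del (hN : Nh + Nr ≤ N) (P : Placement K N Nh Nr) (d : Fin K → Fin N)
    (L : Fin K → Finset (Pair K)) :
    ∃ Δ : Fin K → Fin K → Finset (Pair K),
      (∀ i ∈ Kh Nh d, ∀ j ∈ Kl Nh Nr d, Δ i j ⊆ setOmega Nh d i j) ∧
      (∀ i ∈ Kh Nh d, ∀ j ∈ Kl Nh Nr d, (Δ i j).card =
        nOf (setOmega Nh d i j).card (L j).card (setZ Nr d i j).card (setH P d i j).card) ∧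
      ∃ B : Finpartition (univ.filter fun x : Fin K × Pair K =>
          x.1 ∈ Kh Nh d ∧ ∃ j ∈ Kl Nh Nr d, x.2 ∈ Δ x.1 j),
        (∀ p ∈ B.parts, p.card = 1 ∨ ∃ i k : Fin K, ∃ s t : Pair K,
          i ≠ k ∧ i ∈ t.1 ∧ k ∈ s.1 ∧ p = {(i, s), (k, t)}) ∧
        (B.parts.filter fun p => p.card = 1).card ≤ 1 := by
  obtain ⟨Δ, hΔ, B⟩ := exists_exchangeable_subsets (disjoint_Kh_Kl d)
    (fun j => nOf ((Kh Nh d).card - 1) (L j).card (Kr Nr d).card ((K - 1) / 2))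
    fun _ _ => Nat.sub_le _ _
  refine ⟨Δ, fun i hi j hj => ?_, fun i hi j hj => ?_, B⟩
  · rw [setOmega_eq_pairsWith hi hj]
    exact (hΔ i hi j hj).1
  · rw [(hΔ i hi j hj).2, card_setOmega hi hj, card_setZ hN hi hj, card_setH hj]

theorem exists_cross [Nonempty (Pair K)] (hN : Nh + Nr ≤ N) (hi : i ∈ Kh Nh d)
    (hj : j ∈ Kl Nh Nr d) {L Q Δ : Finset (Pair K)} (hL : L ⊆ setLambda Nh Nr d)
    (hQ : Q ⊆ setZ Nr d i j)
    (hQcard : (setZ Nr d i j \ Q).card =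
      sigmaOf L.card (setZ Nr d i j).card (setH P d i j).card)
    (hΔ : Δ ⊆ setOmega Nh d i j)
    (hΔcard : Δ.card =
      nOf (setOmega Nh d i j).card L.card (setZ Nr d i j).card (setH P d i j).card) :
    ∃ φ : Pair K → Pair K,
      Set.MapsTo φ (L ∪ Q ∪ (setOmega Nh d i j \ Δ) : Finset (Pair K)) (setH P d i j) ∧
      Set.InjOn φ (L ∪ Q ∪ (setOmega Nh d i j \ Δ) : Finset (Pair K)) := by
  refine exists_injOn_of_card_le ?_
  rw [card_union_of_subset_setLambda_setZ_setOmega hN hi hj hL hQ sdiff_subset,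
    card_sdiff_of_subset hΔ, hΔcard, nOf]
  rw [card_sdiff_of_subset hQ, sigmaOf] at hQcard
  have := card_le_card hQ
  omega

theorem nonempty_delivery (hK : 2 ≤ K) (hN : Nh + Nr ≤ N) (P : Placement K N Nh Nr)
    (d : Fin K → Fin N) : Nonempty (Delivery P d) := by
  have : Nonempty (Pair K) :=
    ⟨⟨{⟨0, by omega⟩, ⟨1, by omega⟩}, card_pair (Fin.ne_of_val_ne zero_ne_one)⟩⟩
  obtain ⟨L, L_subset, cover, disjoint, equitable⟩ := exists_Lam Nh Nr d
  have pi : ∀ i ∈ Kh Nh d, ∀ j ∈ Kl Nh Nr d, ∃ Q ⊆ setZ Nr d i j, (setZ Nr d i j \ Q).card =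
      sigmaOf (L j).card (setZ Nr d i j).card (setH P d i j).card := fun i hi j hj =>
    exists_Pi (card_le_card_setH hN cover disjoint equitable hi hj)
  choose! Pi Pi_subset Pi_card using pi
  obtain ⟨Del, Del_subset, Del_card, B, B_parts, B_single⟩ := exists_Del hN P d L
  have cross : ∀ i ∈ Kh Nh d, ∀ j ∈ Kl Nh Nr d, ∃ φ : Pair K → Pair K,
      Set.MapsTo φ (L j ∪ Pi i j ∪ (setOmega Nh d i j \ Del i j) : Finset (Pair K)) (setH P d i j) ∧
      Set.InjOn φ (L j ∪ Pi i j ∪ (setOmega Nh d i j \ Del i j) : Finset (Pair K)) :=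
    fun i hi j hj => exists_cross hN hi hj (cover ▸ subset_biUnion_of_mem L hj)
      (Pi_subset i hi j hj) (Pi_card i hi j hj) (Del_subset i hi j hj) (Del_card i hi j hj)
  choose! cross cross_maps cross_inj using cross
  have lowPair : ∀ j ∈ Kl Nh Nr d, ∀ k ∈ Kl Nh Nr d, ∃ ψ : Pair K → Pair K,
      Set.BijOn ψ (setH P d k j) (setH P d j k) := fun _ hj _ hk => exists_lowPair hj hk
  choose! lowPair lowPair_bij using lowPair
  exact ⟨{
    lowPair, Pi, Pi_subset, Pi_card, Del, Del_subset, Del_card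
    cross, cross_maps, cross_inj, B, B_parts, B_single
    lowPair_bij := fun j hj k hk _ => lowPair_bij j hj k hk
    Lam := fun _ => L
    Lam_subset := L_subset
    Lam_cover := fun _ _ => cover
    Lam_disjoint := fun _ _ _ hj _ hk => disjoint hj hk
    Lam_uniform := fun _ _ _ hj _ hk => equitable hk hj
    Lam_same := fun _ _ _ _ _ _ => rfl }⟩

end Choices

end CL210

theorem mainTheorem2 (K N Nh Nr b : ℕ) (hK : Odd K) (hK3 : 3 ≤ K) (hN : Nh + Nr ≤ N) (hb : 0 < b) :
    Nonempty (CL210.Placement K N Nh Nr) ∧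
    ∀ P : CL210.Placement K N Nh Nr,
      -- every cache holds `M * F` bits
      (∀ u : Fin K, (((P.cache u).card * b : ℕ) : ℚ) =
        CL210.cacheSize K N Nh Nr * (CL210.fileSize K b : ℚ)) ∧
      ∀ (d : Fin K → Fin N) (kh kl kr : ℕ), kh = (CL210.Kh Nh d).card →
        kl = (CL210.Kl Nh Nr d).card → kr = (CL210.Kr Nr d).card →
        -- the delivery phase can be carried out
        Nonempty (CL210.Delivery P d) ∧
        ∀ D : CL210.Delivery P d,
          -- the quantities `|F|`, `|Λ|`, `σ` and `n`
          (∀ i ∈ CL210.Kh Nh d, ∀ j ∈ CL210.Kl Nh Nr d,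
            (¬ (kh = 1 ∧ kr = 0) → (D.F i j).card = (CL210.setH P d i j).card) ∧
            ((D.Lam i j).card = (kl - 1) / 2 ∨ (D.Lam i j).card = kl / 2) ∧
            D.sigma i j = CL210.sigmaOf (D.Lam i j).card kr ((K - 1) / 2) ∧
            D.n i j = CL210.nOf (kh - 1) (D.Lam i j).card kr ((K - 1) / 2)) ∧
          -- the number of messages in each step
          D.step1.card = (kh + kr).choose 3 - kr.choose 3 ∧
          D.step2.card = (K - 1) / 2 * kl.choose 2 ∧
          D.step3.card = (K - 1) / 2 * (kh * kl) ∧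
          D.step4.card =
            ⌈((∑ i ∈ CL210.Kh Nh d, ∑ j ∈ CL210.Kl Nh Nr d, D.n i j : ℕ) : ℚ) / 2⌉₊ ∧
          D.step5low.card = kl * kr * ((K - 1) / 2) ∧
          D.step5high.card = ∑ i ∈ CL210.Kh Nh d, ∑ j ∈ CL210.Kl Nh Nr d, D.sigma i j ∧
          D.step5zero.card = kr * K.choose 2 ∧
          -- their total, as a function of `k = [kh, kl, kr]`
          D.step1.card + D.step2.card + D.step3.card + D.step4.card +
            (D.step5low.card + D.step5high.card) = CL210.NT K kh kl kr ∧
          -- every user recovers the requested file, at the stated rate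
          D.Decodable b ∧
          D.rate b = (CL210.NT K kh kl kr : ℚ) / (K.choose 2 : ℚ) + (kr : ℚ) := by
  refine ⟨CL210.nonempty_placement hK, fun P => ⟨P.cache_bits hK hN b, ?_⟩⟩
  rintro d _ _ _ rfl rfl rfl
  refine ⟨CL210.nonempty_delivery (by omega) hN P d, fun D => ⟨fun i hi j hj => ?_, D.card_step1 hN,
    D.card_step2, D.card_step3, D.card_step4, D.card_step5low, D.card_step5high, D.card_step5zero,
    D.card_steps hN, D.decodable hN b, D.rate_eq (by omega) hN hb⟩⟩
  exact ⟨D.card_F hK hN hi hj, D.card_Lam hi hj, D.sigma_eq hN hi hj, D.n_eq hN hi hj⟩
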